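/- Let $E$ be a Hausdorff, sequentially complete, barreled locally convex space over $\mathbb{C}$, let $L(E)$ be the space of continuous linear operators on $E$ with the topology of uniform convergence on bounded sets, and let $C\in L(E)$ (not necessarily injective). A multivalued linear operator (MLO) $\mathcal{A}$ in $E$ is identified with its graph, a linear subspace of $E\times E$; it is closed if this subspace is closed, $(\lambda-\mathcal{A})x=\{\lambda x-y: y\in\mathcal{A}x\}$ and $\mathcal{A}^{-1}y=\{x: y\in\mathcal{A}x\}$. Let $\mathcal{D}=C_0^\infty(\mathbb{R})$ be the space of complex test functions with its usual topology, $\mathcal{D}_0=\{\varphi\in\mathcal{D}:\operatorname{supp}\varphi\subseteq[0,\infty)\}$, and $(\varphi*_0\psi)(t)=\int_0^t\varphi(t-s)\psi(s)\,ds$, $t\in\mathbb{R}$. A continuous linear map $\mathcal{G}:\mathcal{D}\to L(E)$ with support in $[0,\infty)$ is a pre-($C$-DS) if $C\mathcal{G}(\varphi)=\mathcal{G}(\varphi)C$ and $\mathcal{G}(\varphi*_0\psi)C=\mathcal{G}(\varphi)\mathcal{G}(\psi)$ for all $\varphi,\psi\in\mathcal{D}$. Its generator is the MLO $\{(x,y)\in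 E\times E:\ \mathcal{G}((-\delta')*\varphi)x=\mathcal{G}(\varphi)y\ \text{ for all }\varphi\in\mathcal{D}_0\}$, where $(-\delta')*\varphi=-\varphi'$. For $a,b>0$ put $E(a,b)=\{\lambda\in\mathbb{C}:\Re\lambda\ge b,\ |\Im\lambda|\le e^{a\Re\lambda}\}$, let $\Gamma_{a,b}$ be the upwards oriented boundary of $E(a,b)$ and $\Omega_{a,b}=\{\lambda:\Re\lambda>b,\ |\Im\lambda|<e^{a\Re\lambda}\}$ the open region to the right of $\Gamma_{a,b}$. For $\varphi\in\mathcal{D}$ put $\hat\varphi(\lambda)=\frac{1}{2\pi}\int_{-\infty}^{\infty}e^{\lambda t}\varphi(t)\,dt$, $\lambda\in\mathbb{C}$. **Theorem 4.10.** Let $a>0$, $b>0$, $\alpha>0$, and let $\mathcal{A}$ be a closed MLO in $E$. Suppose that for every $\lambda\in E(a,b)$ there is an operator $F(\lambda)\in L(E)$ such that - $F(\lambda)\mathcal{A}\subseteq\mathcal{A}F(\lambda)$, i.e. $(F(\lambda)x,F(\lambda)y)\in\mathcal{A}$ whenever $(x,y)\in\mathcal{A}$; - $F(\lambda)x\in(\lambda-\mathcal{A})^{-1}Cx$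 for all $x\in E$; - $F(\lambda)C=CF(\lambda)$; - $\lambda F(\lambda)x-Cx=F(\lambda)y$ whenever $(x,y)\in\mathcal{A}$. Suppose also that for every $x\in E$ the map $\lambda\mapsto F(\lambda)x$ on $E(a,b)$ is analytic on $\Omega_{a,b}$ and continuous on $E(a,b)=\Omega_{a,b}\cup\Gamma_{a,b}$, and that the family $\{(1+|\lambda|)^{-\alpha}F(\lambda):\lambda\in E(a,b)\}\subseteq L(E)$ is equicontinuous. Then for all $\varphi\in\mathcal{D}$ and $x\in E$ the integral $$\mathcal{G}(\varphi)x=(-i)\int_{\Gamma_{a,b}}\hat\varphi(\lambda)F(\lambda)x\,d\lambda$$ converges absolutely in $E$ (with respect to every continuous seminorm), and this formula defines a pre-($C$-DS) $\mathcal{G}$ whose generator is an extension of $\mathcal{A}$, i.e. contains $\mathcal{A}$. -/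

import Mathlib

open MeasureTheory Topology Filter Set
open scoped Distributions Convolution ContDiff

namespace DegenerateCDS

/-! ### Multivalued linear operators -/

/-- A multivalued linear operator (MLO) in `E`, identified with its graph, a linear subspace of
`E × E`: the pair `(x, y)` belongs to `A` iff `y ∈ A x`. -/
abbrev MLO (E : Type*) [AddCommGroup E] [Module ℂ E] := Submodule ℂ (E × E)

namespace MLO

variable {E : Type*} [AddCommGroup E] [Module ℂ E]

/-- The inverse of an MLO: `A⁻¹ y = {x | y ∈ A x}`. -/
def inverse (A : MLO E) : MLO E where
  carrier := {q | (q.2, q.1) ∈ A}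
  add_mem' hp hq := A.add_mem hp hq
  zero_mem' := A.zero_mem
  smul_mem' c _ hp := A.smul_mem c hp

/-- The MLO `z - A`, that is `(z - A) x = {z x - y | y ∈ A x}`. -/
def scalarSub (z : ℂ) (A : MLO E) : MLO E where
  carrier := {q | ∃ y, (q.1, y) ∈ A ∧ q.2 = z • q.1 - y}
  add_mem' := by
    rintro p q ⟨y, hy, hp⟩ ⟨w, hw, hq⟩
    refine ⟨y + w, A.add_mem hy hw, ?_⟩
    simp only [Prod.fst_add, Prod.snd_add, hp, hq, smul_add]
    abel
  zero_mem' := ⟨0, A.zero_mem, by simp⟩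
  smul_mem' := by
    rintro c p ⟨y, hy, hp⟩
    refine ⟨c • y, A.smul_mem c hy, ?_⟩
    simp only [Prod.smul_fst, Prod.smul_snd, hp, smul_sub, smul_comm c z]

end MLO

/-- Sequential completeness: every Cauchy sequence converges. -/
def SeqComplete (E : Type*) [UniformSpace E] : Prop :=
  ∀ u : ℕ → E, CauchySeq u → ∃ x, Tendsto u atTop (𝓝 x)

/-! ### Test functions and vector-valued distributions -/

/-- The space `𝒟` of smooth compactly supported functions `ℝ → ℂ`, with its LF topology. -/
abbrev Test := 𝓓((⊤ : TopologicalSpace.Opens ℝ), ℂ)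

/-- The test functions with support in `[0, ∞)`. -/
def Test₀ : Set Test := {φ | tsupport φ ⊆ Ici 0}

theorem test_integrable (φ : Test) : Integrable (φ : ℝ → ℂ) :=
  φ.continuous.integrable_of_hasCompactSupport φ.hasCompactSupport

theorem finiteConv_eq (φ ψ : Test) :
    (fun t : ℝ => ∫ s in (0 : ℝ)..t, φ (t - s) * ψ s) =
      ((Ici (0 : ℝ)).indicator φ ⋆[ContinuousLinearMap.mul ℝ ℂ] ψ)
        - ((Iic (0 : ℝ)).indicator ψ ⋆[ContinuousLinearMap.mul ℝ ℂ] φ) := by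
  funext t
  have hint : Integrable (fun s : ℝ => φ (t - s) * ψ s) := by
    refine Continuous.integrable_of_hasCompactSupport ?_ ?_
    · exact (φ.continuous.comp (continuous_const.sub continuous_id)).mul ψ.continuous
    · exact ψ.hasCompactSupport.mul_left
  rw [← intervalIntegral.integral_Iic_sub_Iic hint.integrableOn hint.integrableOn]
  simp only [Pi.sub_apply, convolution_def, ContinuousLinearMap.mul_apply']
  congr 1
  · rw [← integral_sub_left_eq_self (fun s => (Ici (0 : ℝ)).indicator φ s * ψ (t - s)) volume t,
      ← integral_indicator measurableSet_Iic]
    congr 1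
    funext s
    by_cases hs : s ≤ t
    · simp [hs]
    · simp [hs]
  · rw [← integral_indicator measurableSet_Iic]
    congr 1
    funext s
    by_cases hs : s ∈ Iic (0 : ℝ)
    · simp [hs, mul_comm]
    · simp [hs]

theorem contDiff_finiteConv (φ ψ : Test) :
    ContDiff ℝ ∞ (fun t : ℝ => ∫ s in (0 : ℝ)..t, φ (t - s) * ψ s) := by
  rw [finiteConv_eq]
  exact (ψ.hasCompactSupport.contDiff_convolution_right _
    ((test_integrable φ).indicator measurableSet_Ici).locallyIntegrable ψ.contDiff).sub
    (φ.hasCompactSupport.contDiff_convolution_right _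
    ((test_integrable ψ).indicator measurableSet_Iic).locallyIntegrable φ.contDiff)

theorem hasCompactSupport_finiteConv (φ ψ : Test) :
    HasCompactSupport (fun t : ℝ => ∫ s in (0 : ℝ)..t, φ (t - s) * ψ s) := by
  rw [finiteConv_eq]
  have h (s : Set ℝ) (χ : Test) : HasCompactSupport (s.indicator χ) :=
    χ.hasCompactSupport.mono (by
      rw [Set.support_indicator]
      exact inter_subset_right)
  have h1 := HasCompactSupport.convolution (μ := volume) (ContinuousLinearMap.mul ℝ ℂ)
    (h (Ici 0) φ) ψ.hasCompactSupport
  have h2 := HasCompactSupport.convolution (μ := volume) (ContinuousLinearMap.mul ℝ ℂ)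
    (h (Iic 0) ψ) φ.hasCompactSupport
  exact h1.sub h2

/-- The convolution product `(φ *₀ ψ)(t) = ∫₀ᵗ φ(t - s) ψ(s) ds`, `t ∈ ℝ`. -/
noncomputable def finiteConv (φ ψ : Test) : Test where
  toFun t := ∫ s in (0 : ℝ)..t, φ (t - s) * ψ s
  contDiff' := contDiff_finiteConv φ ψ
  hasCompactSupport' := hasCompactSupport_finiteConv φ ψ
  tsupport_subset' := subset_univ _

theorem negDeltaDerivConv_eq (φ : Test) :
    (fun t : ℝ => deriv (fun s : ℝ => φ (t - s)) 0) = -deriv φ := by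
  funext t
  rw [deriv_comp_const_sub]
  simp

/-- The convolution `(-δ') * φ` of a test function with the distribution `-δ'`. The convolution is
`(T * φ)(t) = T(φ(t - ·))`, and `-δ'` acts by `(-δ')(χ) = χ'(0)`; the result is `-φ'`
(`negDeltaDerivConv_eq`). -/
noncomputable def negDeltaDerivConv (φ : Test) : Test where
  toFun t := deriv (fun s : ℝ => φ (t - s)) 0
  contDiff' := by
    rw [negDeltaDerivConv_eq]
    exact ((contDiff_infty_iff_deriv.mp φ.contDiff).2).neg
  hasCompactSupport' := by
    rw [negDeltaDerivConv_eq]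
    exact φ.hasCompactSupport.deriv.neg
  tsupport_subset' := subset_univ _

section Distributions

variable {E : Type*} [AddCommGroup E] [Module ℂ E] [TopologicalSpace E] [IsTopologicalAddGroup E]
  [ContinuousSMul ℂ E]

variable (E) in
/-- The space `𝒟'(L(E))` of `L(E)`-valued distributions, where `L(E)` carries the topology of
uniform convergence on bounded sets. -/
abbrev OpDistribution := Test →L[ℂ] (E →L[ℂ] E)

/-- `G` is a pre-(C-DS): `G` is supported in `[0, ∞)`, commutes with `C`, and
`G(φ *₀ ψ) C = G(φ) G(ψ)` for all test functions `φ, ψ`. -/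
structure IsPreCDS (C : E →L[ℂ] E) (G : OpDistribution E) : Prop where
  support_subset : Distribution.dsupport (G : Test → (E →L[ℂ] E)) ⊆ Ici 0
  commute : ∀ φ : Test, C ∘L G φ = G φ ∘L C
  conv : ∀ φ ψ : Test, G (finiteConv φ ψ) ∘L C = G φ ∘L G ψ

/-- The (infinitesimal) generator `G(-δ')`, i.e. the set of all `(x, y)` such that
`G((-δ') * φ) x = G(φ) y` for every test function `φ` supported in `[0, ∞)`. -/
def generator (G : OpDistribution E) : MLO E where
  carrier := {q | ∀ φ ∈ Test₀, G (negDeltaDerivConv φ) q.1 = G φ q.2}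
  add_mem' hp hq φ hφ := by
    simp only [Prod.fst_add, Prod.snd_add, map_add, hp φ hφ, hq φ hφ]
  zero_mem' φ _ := by simp
  smul_mem' c p hp φ hφ := by
    simp only [Prod.smul_fst, Prod.smul_snd, map_smul, hp φ hφ]

end Distributions

/-! ### The contour and the integral over it -/

/-- The exponential region `E(a, b)`. -/
def expRegion (a b : ℝ) : Set ℂ := {z | b ≤ z.re ∧ |z.im| ≤ Real.exp (a * z.re)}

/-- The open region `Ω_{a,b}` to the right of the boundary of `E(a, b)`. -/
def openExpRegion (a b : ℝ) : Set ℂ := {z | b < z.re ∧ |z.im| < Real.exp (a * z.re)}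

/-- The upwards oriented boundary `Γ_{a,b}` of `E(a, b)` (for `a, b > 0`), parametrized by the
imaginary part `s ∈ ℝ`: the point with imaginary part `s` is `b + i s` if `|s| ≤ e^{ab}`, and it is
`(log |s|) / a + i s` if `|s| ≥ e^{ab}`. -/
noncomputable def contour (a b : ℝ) (s : ℝ) : ℂ := ⟨max b (Real.log |s| / a), s⟩

/-- `φ̂(z) = (1 / 2π) ∫ e^{z t} φ(t) dt`. -/
noncomputable def hat (φ : Test) (z : ℂ) : ℂ :=
  (2 * (Real.pi : ℂ))⁻¹ * ∫ t : ℝ, Complex.exp (z * t) * φ t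

section Integral

variable {E : Type*} [AddCommGroup E] [Module ℂ E] [TopologicalSpace E]

/-- The function `f` with values in a locally convex space is absolutely integrable (`∫ p(f) dμ` is
finite for every continuous seminorm `p`) with integral `I`, the vector determined (when `E` is
Hausdorff and locally convex) by `ℓ(I) = ∫ ℓ(f) dμ` for every continuous linear functional `ℓ`. -/
def HasIntegral {X : Type*} [MeasurableSpace X] (μ : Measure X) (f : X → E) (I : E) : Prop :=
  (∀ p : Seminorm ℂ E, Continuous p → Integrable (fun s => p (f s)) μ) ∧
    ∀ l : E →L[ℂ] ℂ, Integrable (fun s => l (f s)) μ ∧ ∫ s, l (f s) ∂μ = l I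

/-- `I = ∫_{Γ_{a,b}} f(z) dz` for the upwards oriented contour, with `dz = γ'(s) ds`
(`γ` is differentiable except at `s = ± e^{ab}`). -/
def HasContourIntegral (a b : ℝ) (f : ℂ → E) (I : E) : Prop :=
  HasIntegral volume (fun s : ℝ => deriv (contour a b) s • f (contour a b s)) I

end Integral

end DegenerateCDS

open DegenerateCDS

/-! The seminorms of `E` are norming suprema of continuous functionals (Hahn–Banach), so once the
contour integrals exist as vectors, every identity can be tested on `l : E →L[ℂ] ℂ`. It then
concerns scalar functions `g(z) = l (F z x)`, holomorphic inside the region, continuous up to its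
boundary and `O(|z|^α)`.

Convergence. If `φ` vanishes to the right of `S`, then `φ̂(z)` is `O((1 + |z|)^(-k) e^(S Re z))` for
every `k`. On the contour `Re z` grows only like `log |s| / a`, so the exponential is a power of
`|s|` and a large `k` wins. Sequential completeness provides the integral, and the same estimate,
uniform for `φ` supported in a fixed compact set, makes `G` continuous. If `φ` lives on `(-∞, 0]`
there is no exponential growth, and Cauchy's theorem to the right of the contour gives `G φ = 0`.

Product formula. The hypotheses yield the resolvent equation `(w - z) F(w) F(z) x = F(z) C x - F(w)
C x`. Dividing by `w - z` would be singular when both variables lie on one contour. Instead `F(w)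
F(z) x` is compared with `e^((z-w)T)` times itself. The latter amounts to translating `φ` by `T`
into the negative half line, where it contributes nothing; the difference is an integral over `σ ∈
[0, T]` involving only `F(z) C x` and `F(w) C x` (`contourPairing_resolvent`). The inversion formula
`∫ f̂ dz = i f(0)` (`integral_contour_laplace`) and Fubini then reproduce the transform of `φ *₀ ψ`
given by `hat_finiteConv`.

Generator. The transform of `-φ'` is `z φ̂`, and `z F(z) x - F(z) y = C x` for `(x, y) ∈ A`. The
defect in the generator condition is thus a multiple of `∫ φ̂ dz = i φ(0)`, which is zero for `φ ∈
Test₀`. -/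

namespace DegenerateCDS

/-! ### Integration in sequentially complete locally convex spaces. -/

section VectorIntegral

variable {E : Type*} [AddCommGroup E] [Module ℂ E] [UniformSpace E]

/-- The approximating sums `∑ r, (∫_{t = r} m) • Φ r` for the integral of `m • Φ`. -/
noncomputable def simpleSum (m : ℝ → ℂ) (Φ : ℝ → E) (t : SimpleFunc ℝ ℝ) : E :=
  ∑ r ∈ t.range, (∫ s in t ⁻¹' {r}, m s) • Φ r

theorem dual_simpleSum {m : ℝ → ℂ} (hm : Integrable m) (Φ : ℝ → E) (t : SimpleFunc ℝ ℝ)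
    (l : E →L[ℂ] ℂ) : l (simpleSum m Φ t) = ∫ s, m s * l (Φ (t s)) := by
  have : (fun s => m s * l (Φ (t s))) =
      fun s => ∑ r ∈ t.range, (t ⁻¹' {r}).indicator (fun s => m s * l (Φ r)) s := by
    funext s
    rw [Finset.sum_eq_single (t s)]
    · simp [indicator]
    · intro r _ hr
      simp [indicator, hr.symm]
    · intro h
      exact absurd (SimpleFunc.mem_range_self t s) h
  rw [this, integral_finsetSum _ fun r _ =>
    (hm.mul_const _).indicator (SimpleFunc.measurableSet_fiber t r)]
  simp only [simpleSum, map_sum, map_smul, smul_eq_mul]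
  refine Finset.sum_congr rfl fun r _ => ?_
  rw [integral_indicator (SimpleFunc.measurableSet_fiber t r), integral_mul_const]

variable [IsUniformAddGroup E] [ContinuousSMul ℂ E] [LocallyConvexSpace ℝ E]

open scoped ComplexOrder in
theorem polynormableSpace_complex : PolynormableSpace ℂ E := by
  have : ContinuousSMul ℝ E := IsScalarTower.continuousSMul ℂ
  have : LocallyConvexSpace ℂ E := by
    refine LocallyConvexSpace.ofBasisZero ℂ E _ _ (LocallyConvexSpace.convex_basis_zero ℝ E) ?_
    intro s hs
    exact convex_of_nonneg_surjective_algebraMap _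
      (fun _ h => RCLike.nonneg_iff_exists_ofReal.mp h) hs.2
  infer_instance

/-- Hahn–Banach: the functional `c • v ↦ c * p v` on the line through `v` is dominated by `p` and
extends with the same domination. -/
theorem exists_dual_eq_seminorm (p : Seminorm ℂ E) (hp : Continuous p) (v : E) :
    ∃ l : E →L[ℂ] ℂ, l v = p v ∧ ∀ x, ‖l x‖ ≤ p x := by
  have := polynormableSpace_complex (E := E)
  by_cases hv : v = 0
  · exact ⟨0, by simp [hv], fun x => by simp⟩
  obtain ⟨g, hg, hgp⟩ := Module.Dual.exists_continuous_extension_of_le_seminorm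
    (Submodule.span ℂ {v}) ((p v : ℂ) • (LinearEquiv.coord ℂ E v hv).toLinearMap) hp (by
      intro x
      obtain ⟨c, hc⟩ := Submodule.mem_span_singleton.1 x.2
      have : x = c • ⟨v, Submodule.mem_span_singleton_self v⟩ := Subtype.ext hc.symm
      rw [this, map_smul]
      simp [LinearEquiv.coord_self, map_smul_eq_mul, abs_of_nonneg (apply_nonneg p v)])
  refine ⟨g, ?_, hgp⟩
  rw [hg ⟨v, Submodule.mem_span_singleton_self v⟩]
  simp [LinearEquiv.coord_self]

theorem eq_of_forall_dual_eq [T2Space E] {v w : E} (h : ∀ l : E →L[ℂ] ℂ, l v = l w) : v = w := by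
  have := polynormableSpace_complex (E := E)
  by_contra hvw
  have : v - w ≠ 0 := sub_ne_zero.2 hvw
  obtain ⟨p, hp⟩ := (PolynormableSpace.withSeminorms ℂ E).separating_of_T1 _ this
  obtain ⟨l, hl, -⟩ := exists_dual_eq_seminorm p.1 p.2 (v - w)
  rw [map_sub, h l, sub_self] at hl
  exact hp (by exact_mod_cast hl.symm)

theorem seminorm_le_of_forall_dual {p : Seminorm ℂ E} (hp : Continuous p) {v : E} {B : ℝ}
    (h : ∀ l : E →L[ℂ] ℂ, (∀ x, ‖l x‖ ≤ p x) → ‖l v‖ ≤ B) : p v ≤ B := by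
  obtain ⟨l, hl, hlp⟩ := exists_dual_eq_seminorm p hp v
  simpa [hl, abs_of_nonneg (apply_nonneg p v)] using h l hlp

theorem cauchySeq_of_seminorm_sub_le {u : ℕ → E}
    (h : ∀ p : Seminorm ℂ E, Continuous p → ∃ e : ℕ → ℝ, Tendsto e atTop (𝓝 0) ∧
      ∀ m n, p (u m - u n) ≤ e m + e n) : CauchySeq u := by
  have := polynormableSpace_complex (E := E)
  rw [cauchySeq_iff_tendsto, uniformity_eq_comap_nhds_zero, tendsto_comap_iff,
    (PolynormableSpace.withSeminorms ℂ E).tendsto_nhds]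
  rintro p ε hε
  obtain ⟨e, he, hle⟩ := h p.1 p.2
  have h1 : ∀ᶠ n in atTop, e n < ε / 2 := he.eventually (gt_mem_nhds (half_pos hε))
  rw [← prod_atTop_atTop_eq]
  filter_upwards [h1.prod_mk h1] with q hq
  have := hle q.2 q.1
  simp only [Function.comp, Prod.map, sub_zero]
  exact this.trans_lt (by linarith [hq.1, hq.2])

/-- Simple functions `t n → id` pointwise give a sequence of sums, so sequential completeness
suffices. The sums are Cauchy because, under a functional dominated by `p`, two of them differ by at
most the sum of the errors `∫ ‖m s‖ * p (Φ (t n s) - Φ s)`, which tend to zero by dominated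
convergence. Boundedness of `Φ` and integrability of `m` provide the majorant. -/
theorem exists_hasIntegral_smul (hE : SeqComplete E) {m : ℝ → ℂ} (hm : Integrable m)
    {Φ : ℝ → E} (hΦ : Continuous Φ)
    (hb : ∀ p : Seminorm ℂ E, Continuous p → ∃ B, ∀ s, p (Φ s) ≤ B) :
    ∃ I : E, HasIntegral volume (fun s => m s • Φ s) I := by
  set t : ℕ → SimpleFunc ℝ ℝ :=
    SimpleFunc.approxOn (id : ℝ → ℝ) measurable_id univ 0 (mem_univ _) with ht
  have htl (s : ℝ) : Tendsto (fun n => t n s) atTop (𝓝 s) :=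
    SimpleFunc.tendsto_approxOn measurable_id (mem_univ _) (by simp)
  have hint (l : E →L[ℂ] ℂ) : Integrable fun s => m s * l (Φ s) := by
    obtain ⟨B, hB⟩ := hb l.toLinearMap.toSeminorm l.continuous.norm
    exact hm.mul_bdd (c := B) (l.continuous.comp hΦ).aestronglyMeasurable (.of_forall hB)
  have hintt (l : E →L[ℂ] ℂ) (n : ℕ) : Integrable fun s => m s * l (Φ (t n s)) := by
    obtain ⟨B, hB⟩ := hb l.toLinearMap.toSeminorm l.continuous.norm
    refine hm.mul_bdd (c := B) ?_ (.of_forall fun s => hB _)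
    exact ((l.continuous.comp hΦ).measurable.comp (t n).measurable).aestronglyMeasurable
  have hcauchy : CauchySeq fun n => simpleSum m Φ (t n) := by
    refine cauchySeq_of_seminorm_sub_le fun p hp => ?_
    obtain ⟨B, hB⟩ := hb p hp
    have hmeas (n : ℕ) : Measurable fun s => p (Φ (t n s) - Φ s) := by
      have : Continuous fun q : ℝ × ℝ => p (Φ q.1 - Φ q.2) := by fun_prop
      exact this.measurable.comp ((t n).measurable.prodMk measurable_id)
    have hle (n : ℕ) (s : ℝ) : p (Φ (t n s) - Φ s) ≤ B + B :=
      (map_sub_le_add p _ _).trans (add_le_add (hB _) (hB _))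
    have hi (n : ℕ) : Integrable fun s => ‖m s‖ * p (Φ (t n s) - Φ s) := by
      refine hm.norm.mul_bdd (c := B + B) (hmeas n).aestronglyMeasurable (.of_forall fun s => ?_)
      rw [Real.norm_of_nonneg (apply_nonneg _ _)]
      exact hle n s
    refine ⟨fun n => ∫ s, ‖m s‖ * p (Φ (t n s) - Φ s), ?_, fun j n => ?_⟩
    · rw [← integral_zero ℝ ℝ (μ := volume)]
      refine tendsto_integral_of_dominated_convergence (fun s => ‖m s‖ * (B + B))
        (fun n => (hi n).aestronglyMeasurable) (hm.norm.mul_const _) (fun n => .of_forall ?_)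
        (.of_forall ?_)
      · intro s
        rw [Real.norm_of_nonneg (by positivity)]
        exact mul_le_mul_of_nonneg_left (hle n s) (norm_nonneg _)
      · intro s
        have h1 : Continuous fun r => ‖m s‖ * p (Φ r - Φ s) := by fun_prop
        simpa [Function.comp_def] using (h1.tendsto s).comp (htl s)
    · refine seminorm_le_of_forall_dual hp fun l hl => ?_
      rw [map_sub, dual_simpleSum hm, dual_simpleSum hm, ← integral_sub (hintt l j) (hintt l n),
        ← integral_add (hi j) (hi n)]
      refine norm_integral_le_of_norm_le ((hi j).add (hi n)) (.of_forall fun s => ?_)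
      rw [← mul_sub, norm_mul, ← map_sub, ← mul_add]
      refine mul_le_mul_of_nonneg_left ?_ (norm_nonneg _)
      refine (hl _).trans ?_
      have := map_sub_le_add p (Φ (t j s) - Φ s) (Φ (t n s) - Φ s)
      simpa using this
  obtain ⟨I, hI⟩ := hE _ hcauchy
  refine ⟨I, fun p hp => ?_, fun l => ⟨by simpa using hint l, ?_⟩⟩
  · obtain ⟨B, hB⟩ := hb p hp
    simp only [map_smul_eq_mul]
    refine hm.norm.mul_bdd (c := B) (hp.comp hΦ).aestronglyMeasurable (.of_forall fun s => ?_)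
    rw [Real.norm_of_nonneg (apply_nonneg _ _)]
    exact hB s
  · have h1 : Tendsto (fun n => l (simpleSum m Φ (t n))) atTop (𝓝 (l I)) :=
      (l.continuous.tendsto I).comp hI
    refine tendsto_nhds_unique ?_ h1
    simp only [dual_simpleSum hm, map_smul, smul_eq_mul]
    obtain ⟨B, hB⟩ := hb l.toLinearMap.toSeminorm l.continuous.norm
    refine tendsto_integral_of_dominated_convergence (fun s => ‖m s‖ * B)
      (fun n => (hintt l n).aestronglyMeasurable) (hm.norm.mul_const _) (fun n => .of_forall ?_)
      (.of_forall ?_)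
    · intro s
      rw [norm_mul]
      exact mul_le_mul_of_nonneg_left (hB _) (norm_nonneg _)
    · intro s
      have h1 : Continuous fun r => m s * l (Φ r) := by fun_prop
      exact (h1.tendsto s).comp (htl s)

theorem HasIntegral.seminorm_le {X : Type*} [MeasurableSpace X] {μ : Measure X} {f : X → E}
    {I : E} (h : HasIntegral μ f I) {p : Seminorm ℂ E} (hp : Continuous p) :
    p I ≤ ∫ s, p (f s) ∂μ := by
  refine seminorm_le_of_forall_dual hp fun l hl => ?_
  rw [← (h.2 l).2]
  exact norm_integral_le_of_norm_le (h.1 p hp) (.of_forall fun s => hl _)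

end VectorIntegral

/-! ### The two-sided Laplace transform of test functions. -/

section Laplace

/-- The transform `z ↦ (1 / 2π) ∫ e^{z t} f(t) dt` of an arbitrary function on the line. -/
noncomputable def laplace (f : ℝ → ℂ) (z : ℂ) : ℂ :=
  (2 * (Real.pi : ℂ))⁻¹ * ∫ t : ℝ, Complex.exp (z * t) * f t

theorem hat_eq_laplace (φ : Test) : hat φ = laplace φ := rfl

theorem integrable_exp_mul {f : ℝ → ℂ} (hf : Continuous f) (hc : HasCompactSupport f) (z : ℂ) :
    Integrable fun t : ℝ => Complex.exp (z * t) * f t :=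
  Continuous.integrable_of_hasCompactSupport (by fun_prop) hc.mul_left

theorem laplace_add {f g : ℝ → ℂ} (hf : Continuous f) (hcf : HasCompactSupport f)
    (hg : Continuous g) (hcg : HasCompactSupport g) (z : ℂ) :
    laplace (f + g) z = laplace f z + laplace g z := by
  simp only [laplace, Pi.add_apply, mul_add]
  rw [integral_add (integrable_exp_mul hf hcf z) (integrable_exp_mul hg hcg z), mul_add]

theorem laplace_smul (c : ℂ) (f : ℝ → ℂ) (z : ℂ) : laplace (c • f) z = c * laplace f z := by
  simp only [laplace, Pi.smul_apply, smul_eq_mul]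
  simp_rw [mul_left_comm _ c]
  rw [integral_const_mul]
  ring

theorem laplace_comp_add (f : ℝ → ℂ) (T : ℝ) (z : ℂ) :
    laplace (fun t => f (t + T)) z = Complex.exp (-(z * T)) * laplace f z := by
  have : ∫ t : ℝ, Complex.exp (z * t) * f (t + T) =
      ∫ t : ℝ, Complex.exp (-(z * T)) * (Complex.exp (z * t) * f t) := by
    rw [← integral_add_right_eq_self (fun t : ℝ =>
      Complex.exp (-(z * T)) * (Complex.exp (z * t) * f t)) T]
    congr 1
    funext t
    rw [← mul_assoc, ← Complex.exp_add]
    push_cast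
    ring_nf
  rw [laplace, this, integral_const_mul, laplace]
  ring

theorem laplace_deriv {f : ℝ → ℂ} (hf : ContDiff ℝ ∞ f) (hc : HasCompactSupport f) (z : ℂ) :
    laplace (deriv f) z = -(z * laplace f z) := by
  have hd : Continuous (deriv f) := hf.continuous_deriv (by simp)
  have h1 (t : ℝ) : HasDerivAt (fun s : ℝ => Complex.exp (z * s)) (Complex.exp (z * t) * z) t := by
    have := (((hasDerivAt_id (t : ℂ)).const_mul z).cexp).comp_ofReal
    simpa using this
  have h2 (t : ℝ) : HasDerivAt f (deriv f t) t :=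
    (hf.differentiable (by simp) t).hasDerivAt
  have := integral_mul_deriv_eq_deriv_mul_of_integrable (fun t _ => h1 t) (fun t _ => h2 t)
    (integrable_exp_mul hd hc.deriv z)
    (((integrable_exp_mul hf.continuous hc z).const_mul z).congr (.of_forall fun t => by
      simp only [Pi.mul_apply]; ring))
    (integrable_exp_mul hf.continuous hc z)
  rw [laplace, this, laplace]
  have h3 : (fun t : ℝ => Complex.exp (z * t) * z * f t) =
      fun t : ℝ => z * (Complex.exp (z * t) * f t) := by
    funext t; ring
  rw [h3, integral_const_mul]
  ring

/-- In the right half plane `|e^(zt)|` increases with `t`, so only the right end `S` of the support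
enters the exponent. The case `S = 0` later gives the support of the distribution. -/
theorem norm_laplace_le {f : ℝ → ℂ} {L S M : ℝ} (hLS : L ≤ S)
    (hs : ∀ t, t ∉ Icc L S → f t = 0) (hM : ∀ t, ‖f t‖ ≤ M) {z : ℂ} (hz : 0 ≤ z.re) :
    ‖laplace f z‖ ≤ (S - L) * M * Real.exp (S * z.re) := by
  have h1 : ∫ t : ℝ, Complex.exp (z * t) * f t = ∫ t in Icc L S, Complex.exp (z * t) * f t := by
    rw [setIntegral_eq_integral_of_forall_compl_eq_zero]
    intro t ht
    simp [hs t ht]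
  have hM0 : 0 ≤ M := (norm_nonneg _).trans (hM 0)
  have h2 : ‖∫ t in Icc L S, Complex.exp (z * t) * f t‖ ≤
      (Real.exp (S * z.re) * M) * volume.real (Icc L S) := by
    refine norm_setIntegral_le_of_norm_le_const (by simp) fun t ht => ?_
    rw [norm_mul, Complex.norm_exp]
    gcongr
    · simp only [Complex.mul_re, Complex.ofReal_re, Complex.ofReal_im, mul_zero, sub_zero]
      rw [mul_comm]
      exact mul_le_mul_of_nonneg_right ht.2 hz
    · exact hM t
  rw [laplace, h1, norm_mul]
  have h3 : ‖(2 * (Real.pi : ℂ))⁻¹‖ ≤ 1 := by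
    rw [norm_inv, norm_mul, Complex.norm_real, Real.norm_of_nonneg Real.pi_pos.le,
      RCLike.norm_ofNat]
    exact inv_le_one_of_one_le₀ (by linarith [Real.pi_gt_three])
  rw [Real.volume_real_Icc_of_le hLS] at h2
  calc _ ≤ 1 * ((Real.exp (S * z.re) * M) * (S - L)) := by gcongr
    _ = _ := by ring

theorem laplace_iteratedDeriv {f : ℝ → ℂ} (hf : ContDiff ℝ ∞ f) (hc : HasCompactSupport f)
    (k : ℕ) (z : ℂ) : laplace (iteratedDeriv k f) z = (-z) ^ k * laplace f z := by
  induction k generalizing f with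
  | zero => simp
  | succ k ih =>
    rw [iteratedDeriv_succ', ih (contDiff_infty_iff_deriv.mp hf).2 hc.deriv, laplace_deriv hf hc]
    ring

theorem iteratedDeriv_eq_zero_of_notMem_Icc {f : ℝ → ℂ} {L S : ℝ}
    (hs : ∀ t, t ∉ Icc L S → f t = 0) (k : ℕ) {t : ℝ} (ht : t ∉ Icc L S) :
    iteratedDeriv k f t = 0 := by
  have : f =ᶠ[𝓝 t] fun _ => 0 := by
    filter_upwards [isClosed_Icc.isOpen_compl.mem_nhds ht] with s h using hs s h
  rw [this.iteratedDeriv_eq]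
  simp

/-- Each derivative produces a factor `-z`, so the bound for the `k`-th derivative controls `‖z‖ ^
k`. The constants `M₀` and `M` stay explicit so that they can be replaced by seminorms of the test
function when continuity is proved. -/
theorem one_add_norm_pow_mul_norm_laplace_le {f : ℝ → ℂ} (hf : ContDiff ℝ ∞ f) {L S : ℝ}
    (hLS : L ≤ S) (hs : ∀ t, t ∉ Icc L S → f t = 0) (k : ℕ) {M₀ M : ℝ} (hM₀ : ∀ t, ‖f t‖ ≤ M₀)
    (hM : ∀ t, ‖iteratedDeriv k f t‖ ≤ M) {z : ℂ} (hz : 0 ≤ z.re) :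
    (1 + ‖z‖) ^ k * ‖laplace f z‖ ≤ 2 ^ k * ((S - L) * (M₀ + M)) * Real.exp (S * z.re) := by
  have hc : HasCompactSupport f := HasCompactSupport.intro isCompact_Icc hs
  have h0 := norm_laplace_le hLS hs hM₀ hz
  have h1 := norm_laplace_le hLS (fun t => iteratedDeriv_eq_zero_of_notMem_Icc hs k) hM hz
  rw [laplace_iteratedDeriv hf hc, norm_mul, norm_pow, norm_neg] at h1
  have h2 : (1 + ‖z‖) ^ k ≤ 2 ^ k * (1 + ‖z‖ ^ k) := by
    have := add_pow_le zero_le_one (norm_nonneg z) k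
    rw [one_pow] at this
    refine this.trans ?_
    gcongr
    · norm_num
    · omega
  calc (1 + ‖z‖) ^ k * ‖laplace f z‖ ≤ 2 ^ k * (1 + ‖z‖ ^ k) * ‖laplace f z‖ := by gcongr
    _ = 2 ^ k * (‖laplace f z‖ + ‖z‖ ^ k * ‖laplace f z‖) := by ring
    _ ≤ 2 ^ k * ((S - L) * M₀ * Real.exp (S * z.re) + (S - L) * M * Real.exp (S * z.re)) := by
        gcongr
    _ = _ := by ring

theorem exists_norm_laplace_le {f : ℝ → ℂ} (hf : ContDiff ℝ ∞ f) {L S : ℝ}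
    (hLS : L ≤ S) (hs : ∀ t, t ∉ Icc L S → f t = 0) (k : ℕ) :
    ∃ K, 0 ≤ K ∧ ∀ z : ℂ, 0 ≤ z.re →
      (1 + ‖z‖) ^ k * ‖laplace f z‖ ≤ K * Real.exp (S * z.re) := by
  have hc : HasCompactSupport f := HasCompactSupport.intro isCompact_Icc hs
  have hck : HasCompactSupport (iteratedDeriv k f) :=
    HasCompactSupport.intro isCompact_Icc fun t => iteratedDeriv_eq_zero_of_notMem_Icc hs k
  obtain ⟨M₀, hM₀⟩ := hf.continuous.bounded_above_of_compact_support hc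
  obtain ⟨M, hM⟩ := (hf.continuous_iteratedDeriv k
    (by exact_mod_cast le_top)).bounded_above_of_compact_support hck
  have h0 : 0 ≤ M₀ := (norm_nonneg _).trans (hM₀ 0)
  have h1 : 0 ≤ M := (norm_nonneg _).trans (hM 0)
  have h2 : 0 ≤ S - L := sub_nonneg.2 hLS
  exact ⟨_, by positivity,
    fun z hz => one_add_norm_pow_mul_norm_laplace_le hf hLS hs k hM₀ hM hz⟩

theorem differentiable_laplace {f : ℝ → ℂ} (hf : Continuous f) (hc : HasCompactSupport f) :
    Differentiable ℂ (laplace f) := by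
  intro z
  refine DifferentiableAt.const_mul ?_ _
  have h := hasDerivAt_integral_of_dominated_loc_of_deriv_le (μ := (volume : Measure ℝ))
    (F := fun (w : ℂ) (t : ℝ) => Complex.exp (w * t) * f t)
    (F' := fun (w : ℂ) (t : ℝ) => Complex.exp (w * t) * t * f t)
    (bound := fun t : ℝ => Real.exp ((‖z‖ + 1) * |t|) * |t| * ‖f t‖) (x₀ := z)
    (Metric.ball_mem_nhds z one_pos)
    (.of_forall fun w => (integrable_exp_mul hf hc w).aestronglyMeasurable)
    (integrable_exp_mul hf hc z) (Continuous.aestronglyMeasurable (by fun_prop))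
    (.of_forall fun t w hw => ?_)
    (Continuous.integrable_of_hasCompactSupport (by fun_prop) hc.norm.mul_left)
    (.of_forall fun t w _ => ?_)
  · exact h.2.differentiableAt
  · rw [norm_mul, norm_mul, Complex.norm_exp, Complex.norm_real, Real.norm_eq_abs]
    gcongr
    simp only [Complex.mul_re, Complex.ofReal_re, Complex.ofReal_im, mul_zero, sub_zero]
    refine (le_abs_self _).trans ?_
    rw [abs_mul]
    gcongr
    refine (Complex.abs_re_le_norm w).trans ?_
    have := norm_le_norm_add_norm_sub' w z
    rw [Metric.mem_ball, dist_eq_norm] at hw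
    linarith
  · have := ((hasDerivAt_id w).mul_const (t : ℂ)).cexp.mul_const (f t)
    simpa using this

theorem exists_Icc_of_hasCompactSupport {f : ℝ → ℂ} (hc : HasCompactSupport f) :
    ∃ R, 0 < R ∧ ∀ t, t ∉ Icc (-R) R → f t = 0 := by
  obtain ⟨R, hR0, hR⟩ := hc.isCompact.isBounded.subset_closedBall_lt 0 0
  refine ⟨R, hR0, fun t ht => ?_⟩
  by_contra h
  have := hR (subset_tsupport f h)
  rw [Real.closedBall_eq_Icc] at this
  simp at this ht
  linarith [ht this.1]

/-- Fourier inversion at the origin: the substitution `s = 2πw` cancels the normalisation `1 / 2π`.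
Two powers of decay on the imaginary axis give integrability. -/
theorem integral_laplace_I {f : ℝ → ℂ} (hf : ContDiff ℝ ∞ f) (hc : HasCompactSupport f) :
    Integrable (fun s : ℝ => laplace f (s * Complex.I)) ∧
      ∫ s : ℝ, laplace f (s * Complex.I) = f 0 := by
  obtain ⟨R, hR0, hR⟩ := exists_Icc_of_hasCompactSupport hc
  obtain ⟨K, hK0, hK⟩ := exists_norm_laplace_le hf (by linarith : -R ≤ R) hR 2
  have hcont : Continuous fun s : ℝ => laplace f (s * Complex.I) :=
    (differentiable_laplace hf.continuous hc).continuous.comp (by fun_prop)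
  have hint : Integrable fun s : ℝ => laplace f (s * Complex.I) := by
    refine (integrable_inv_one_add_sq.const_mul K).mono' hcont.aestronglyMeasurable
      (.of_forall fun s => ?_)
    have := hK (s * Complex.I) (by simp)
    simp only [norm_mul, Complex.norm_real, Complex.norm_I, mul_one, Real.norm_eq_abs,
      Complex.mul_re, Complex.ofReal_re, Complex.I_re, mul_zero, Complex.ofReal_im, Complex.I_im,
      sub_zero, Real.exp_zero] at this
    rw [← div_eq_mul_inv, le_div_iff₀ (by positivity), mul_comm]
    refine le_trans ?_ this
    gcongr
    nlinarith [abs_nonneg s, sq_abs s]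
  refine ⟨hint, ?_⟩
  have h2π : (2 * Real.pi) ≠ 0 := by positivity
  have hFinv : FourierTransformInv.fourierInv f =
      fun w : ℝ => (2 * Real.pi : ℂ) * laplace f ((2 * Real.pi * w : ℝ) * Complex.I) := by
    funext w
    rw [Real.fourierInv_eq', laplace, ← mul_assoc, mul_inv_cancel₀ (by exact_mod_cast h2π), one_mul]
    congr 1
    funext t
    rw [smul_eq_mul]
    congr 2
    simp
    ring
  have h := Continuous.fourier_fourierInv_eq hf.continuous
    (hf.continuous.integrable_of_hasCompactSupport hc) (by
      have hF : FourierTransform.fourier f = fun w => FourierTransformInv.fourierInv f (-w) := by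
        funext w
        rw [Real.fourierInv_eq_fourier_neg, neg_neg]
      rw [hF, hFinv]
      exact ((hint.comp_mul_left' h2π).const_mul (2 * Real.pi : ℂ)).comp_neg)
  have h0 := congrFun h 0
  rw [Real.fourier_real_eq, hFinv] at h0
  simp only [mul_zero, neg_zero, AddChar.map_zero_eq_one, one_smul] at h0
  rw [integral_const_mul, Measure.integral_comp_mul_left
    (fun s : ℝ => laplace f (s * Complex.I)) (2 * Real.pi)] at h0
  rw [← h0, Complex.real_smul, abs_of_pos (by positivity)]
  push_cast
  rw [← mul_assoc, mul_inv_cancel₀ (by exact_mod_cast h2π), one_mul]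

/-- Since `t ↦ e^(zt)` is a character, multiplying a convolution by it multiplies both factors by
it. -/
theorem integral_exp_mul_convolution {g h : ℝ → ℂ} (z : ℂ)
    (hg : Integrable fun t : ℝ => Complex.exp (z * t) * g t)
    (hh : Integrable fun t : ℝ => Complex.exp (z * t) * h t) :
    ∫ t : ℝ, Complex.exp (z * t) * (g ⋆[ContinuousLinearMap.mul ℝ ℂ] h) t =
      (∫ t : ℝ, Complex.exp (z * t) * g t) * ∫ t : ℝ, Complex.exp (z * t) * h t := by
  have := integral_convolution (ContinuousLinearMap.mul ℝ ℂ) hg hh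
  rw [ContinuousLinearMap.mul_apply'] at this
  rw [← this]
  congr 1
  funext t
  rw [convolution_def, convolution_def, ← integral_const_mul]
  congr 1
  funext s
  simp only [ContinuousLinearMap.mul_apply']
  have : Complex.exp (z * t) = Complex.exp (z * s) * Complex.exp (z * (t - s : ℝ)) := by
    rw [← Complex.exp_add]; push_cast; ring_nf
  rw [this]
  ring

/-- By `finiteConv_eq`, `φ *₀ ψ` is a difference of ordinary convolutions with the truncations of
`φ` to `[0, ∞)` and of `ψ` to `(-∞, 0]`. Their transforms are kept as integrals over `[0, T]`, the
form in which the product formula delivers them. -/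
theorem hat_finiteConv (φ ψ : Test) {T : ℝ} (hT : 0 ≤ T)
    (hφ : ∀ t, t ∉ Icc (-T) T → φ t = 0) (hψ : ∀ t, t ∉ Icc (-T) T → ψ t = 0) (z : ℂ) :
    hat (finiteConv φ ψ) z =
      (∫ σ in (0 : ℝ)..T, φ σ * Complex.exp (z * σ)) * hat ψ z -
      (∫ σ in (0 : ℝ)..T, ψ (-σ) * Complex.exp (-(z * σ))) * hat φ z := by
  have hi (χ : Test) (s : Set ℝ) (hs : MeasurableSet s) :
      Integrable fun t : ℝ => Complex.exp (z * t) * s.indicator χ t := by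
    refine ((integrable_exp_mul χ.continuous χ.hasCompactSupport z).indicator hs).congr
      (.of_forall fun t => ?_)
    by_cases h : t ∈ s <;> simp [h]
  have hi' (χ : Test) := integrable_exp_mul χ.continuous χ.hasCompactSupport z
  have hc (χ η : Test) (s : Set ℝ) (hs : MeasurableSet s) :
      Integrable fun t : ℝ => Complex.exp (z * t) *
        (s.indicator χ ⋆[ContinuousLinearMap.mul ℝ ℂ] η) t := by
    refine integrable_exp_mul ?_ ?_ z
    · exact (η.hasCompactSupport.contDiff_convolution_right (n := ⊤) _
        ((test_integrable χ).indicator hs).locallyIntegrable η.contDiff).continuous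
    · refine HasCompactSupport.convolution _ (χ.hasCompactSupport.mono ?_) η.hasCompactSupport
      rw [Set.support_indicator]
      exact inter_subset_right
  have e1 : ∫ t : ℝ, Complex.exp (z * t) * (Ici (0 : ℝ)).indicator φ t =
      ∫ σ in (0 : ℝ)..T, φ σ * Complex.exp (z * σ) := by
    rw [intervalIntegral.integral_of_le hT, ← integral_Icc_eq_integral_Ioc,
      ← integral_indicator measurableSet_Icc]
    congr 1
    funext t
    by_cases h : t ∈ Icc 0 T
    · simp [h, h.1, mul_comm]
    · rw [indicator_of_notMem h]
      by_cases h0 : 0 ≤ t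
      · have : t ∉ Icc (-T) T := fun h' => h ⟨h0, h'.2⟩
        simp [hφ t this, h0]
      · simp [h0]
  have e2 : ∫ t : ℝ, Complex.exp (z * t) * (Iic (0 : ℝ)).indicator ψ t =
      ∫ σ in (0 : ℝ)..T, ψ (-σ) * Complex.exp (-(z * σ)) := by
    rw [← integral_neg_eq_self, intervalIntegral.integral_of_le hT, ← integral_Icc_eq_integral_Ioc,
      ← integral_indicator measurableSet_Icc]
    congr 1
    funext t
    by_cases h : t ∈ Icc 0 T
    · simp [h, h.1, mul_comm]
    · rw [indicator_of_notMem h]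
      by_cases h0 : 0 ≤ t
      · have : -t ∉ Icc (-T) T := fun h' => h ⟨h0, by linarith [h'.1]⟩
        simp [hψ (-t) this, h0]
      · simp [h0]
  have e3 : (∫ t : ℝ, Complex.exp (z * t) * finiteConv φ ψ t) =
      (∫ σ in (0 : ℝ)..T, φ σ * Complex.exp (z * σ)) * (∫ t : ℝ, Complex.exp (z * t) * ψ t) -
      (∫ σ in (0 : ℝ)..T, ψ (-σ) * Complex.exp (-(z * σ))) *
        (∫ t : ℝ, Complex.exp (z * t) * φ t) := by
    rw [← e1, ← e2, ← integral_exp_mul_convolution z (hi φ _ measurableSet_Ici) (hi' ψ),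
      ← integral_exp_mul_convolution z (hi ψ _ measurableSet_Iic) (hi' φ),
      ← integral_sub (hc _ _ _ measurableSet_Ici) (hc _ _ _ measurableSet_Iic)]
    congr 1
    funext t
    rw [← mul_sub]
    congr 1
    exact congrFun (finiteConv_eq φ ψ) t
  rw [hat, e3, hat, hat]
  ring

end Laplace

/-! ### Geometry of the contour and decay along it. -/

section Contour

variable {a b : ℝ}

@[simp] theorem contour_re (a b s : ℝ) : (contour a b s).re = max b (Real.log |s| / a) := rfl

@[simp] theorem contour_im (a b s : ℝ) : (contour a b s).im = s := rfl

theorem le_contour_re (a b s : ℝ) : b ≤ (contour a b s).re := le_max_left _ _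

theorem contour_mem_expRegion (ha : 0 < a) (b s : ℝ) : contour a b s ∈ expRegion a b := by
  refine ⟨le_max_left _ _, ?_⟩
  rw [contour_im, contour_re]
  rcases eq_or_ne s 0 with rfl | hs
  · simpa using (Real.exp_pos _).le
  · rw [← Real.exp_log (abs_pos.2 hs), Real.exp_le_exp, Real.exp_log (abs_pos.2 hs)]
    calc Real.log |s| = a * (Real.log |s| / a) := by field_simp
      _ ≤ _ := mul_le_mul_of_nonneg_left (le_max_right _ _) ha.le

/-- As `b > 0`, the maximum ignores negative logarithms. Truncating `|s|` at `1` removes the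
singularity at `s = 0` and leaves a logarithm that is Lipschitz on its range of arguments. -/
theorem contour_re_eq (ha : 0 < a) (hb : 0 < b) (s : ℝ) :
    (contour a b s).re = max b (Real.log (max |s| 1) / a) := by
  rw [contour_re]
  rcases le_total 1 |s| with h | h
  · rw [max_eq_left h]
  · rw [max_eq_right h, Real.log_one, zero_div, max_eq_left hb.le, max_eq_left]
    exact (div_nonpos_of_nonpos_of_nonneg (Real.log_nonpos (abs_nonneg _) h) ha.le).trans hb.le

theorem abs_log_sub_log_le {x y : ℝ} (hx : 1 ≤ x) (hy : 1 ≤ y) :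
    |Real.log x - Real.log y| ≤ |x - y| := by
  have key : ∀ {x y : ℝ}, 1 ≤ y → y ≤ x → Real.log x - Real.log y ≤ x - y := by
    intro x y hy hyx
    have hx0 : 0 < x := by linarith
    have hy0 : 0 < y := by linarith
    rw [← Real.log_div hx0.ne' hy0.ne']
    refine (Real.log_le_sub_one_of_pos (by positivity)).trans ?_
    rw [div_sub_one hy0.ne', div_le_iff₀ hy0]
    nlinarith
  rcases le_total y x with h | h
  · rw [abs_of_nonneg (sub_nonneg.2 (Real.log_le_log (by linarith) h)),
      abs_of_nonneg (sub_nonneg.2 h)]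
    exact key hy h
  · rw [abs_sub_comm, abs_sub_comm x, abs_of_nonneg (sub_nonneg.2 (Real.log_le_log (by linarith) h)),
      abs_of_nonneg (sub_nonneg.2 h)]
    exact key hx h

theorem norm_contour_sub_le (ha : 0 < a) (hb : 0 < b) (s t : ℝ) :
    ‖contour a b s - contour a b t‖ ≤ (1 / a + 1) * |s - t| := by
  have h1 : |(contour a b s - contour a b t).re| ≤ 1 / a * |s - t| := by
    rw [Complex.sub_re, contour_re_eq ha hb, contour_re_eq ha hb]
    refine (abs_max_sub_max_le_max _ _ _ _).trans ?_
    rw [sub_self, abs_zero, max_eq_right (abs_nonneg _), ← sub_div, abs_div, abs_of_pos ha,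
      div_mul_eq_mul_div, one_mul]
    refine div_le_div_of_nonneg_right ?_ ha.le
    refine (abs_log_sub_log_le (le_max_right _ _) (le_max_right _ _)).trans ?_
    refine (abs_max_sub_max_le_max _ _ _ _).trans ?_
    rw [sub_self, abs_zero, max_eq_left (abs_nonneg _)]
    exact abs_abs_sub_abs_le_abs_sub s t
  have h2 : |(contour a b s - contour a b t).im| = |s - t| := by simp
  refine (Complex.norm_le_abs_re_add_abs_im _).trans ?_
  rw [h2]
  linarith

theorem continuous_contour (ha : 0 < a) (hb : 0 < b) : Continuous (contour a b) := by
  refine (LipschitzWith.of_dist_le' (K := 1 / a + 1) fun s t => ?_).continuous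
  rw [dist_eq_norm, Real.dist_eq]
  exact norm_contour_sub_le ha hb s t

theorem norm_deriv_contour_le (ha : 0 < a) (hb : 0 < b) (s : ℝ) :
    ‖deriv (contour a b) s‖ ≤ 1 / a + 1 := by
  have h : LipschitzWith (1 / a + 1).toNNReal (contour a b) := by
    refine LipschitzWith.of_dist_le' fun s t => ?_
    rw [dist_eq_norm, Real.dist_eq]
    exact norm_contour_sub_le ha hb s t
  have := norm_deriv_le_of_lipschitz (x₀ := s) h
  rwa [Real.coe_toNNReal _ (by positivity)] at this

theorem differentiableAt_contour (ha : 0 < a) (hb : 0 < b) {s : ℝ}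
    (hs : s ∉ ({Real.exp (a * b), -Real.exp (a * b)} : Set ℝ)) :
    DifferentiableAt ℝ (contour a b) s := by
  have hs' : |s| ≠ Real.exp (a * b) := by
    intro h
    rcases (abs_eq (Real.exp_pos _).le).1 h with h | h <;> simp [h] at hs
  have heq : contour a b = fun s => ((contour a b s).re : ℂ) + (s : ℂ) * Complex.I := by
    funext s
    exact (Complex.re_add_im _).symm
  have hre : DifferentiableAt ℝ (fun s => (contour a b s).re) s := by
    rcases hs'.lt_or_gt with h | h
    · have : (fun s => (contour a b s).re) =ᶠ[𝓝 s] fun _ => b := by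
        filter_upwards [continuous_abs.continuousAt.eventually (gt_mem_nhds h)] with t ht
        rw [contour_re_eq ha hb, max_eq_left]
        rw [div_le_iff₀ ha, mul_comm, Real.log_le_iff_le_exp (by positivity)]
        exact max_le ht.le (Real.one_le_exp (by positivity))
      exact this.differentiableAt_iff.2 (differentiableAt_const _)
    · have h0 : s ≠ 0 := by
        rintro rfl
        rw [abs_zero] at h
        exact absurd h (Real.exp_pos _).not_gt
      have : (fun s => (contour a b s).re) =ᶠ[𝓝 s] fun s => Real.log s / a := by
        filter_upwards [continuous_abs.continuousAt.eventually (lt_mem_nhds h)] with t ht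
        rw [contour_re, Real.log_abs, max_eq_right]
        rw [le_div_iff₀ ha, mul_comm, ← Real.log_abs,
          Real.le_log_iff_exp_le ((Real.exp_pos _).trans ht)]
        exact ht.le
      exact this.differentiableAt_iff.2 ((Real.differentiableAt_log h0).div_const a)
  rw [heq]
  exact (Complex.ofRealCLM.differentiableAt.comp s hre).add
    ((Complex.ofRealCLM.differentiableAt).mul_const Complex.I)

/-- On the logarithmic branches `e^(T Re z) = |s|^(T/a)`: exponential growth in `Re z` is polynomial
growth in the parameter. -/
theorem exp_mul_contour_re_le (ha : 0 < a) (hb : 0 < b) {T : ℝ} (hT : 0 ≤ T) (s : ℝ) :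
    Real.exp (T * (contour a b s).re) ≤ Real.exp (T * b) * (1 + |s|) ^ (T / a) := by
  have h1 : 1 ≤ (1 + |s|) ^ (T / a) :=
    Real.one_le_rpow (by linarith [abs_nonneg s]) (by positivity)
  rw [contour_re_eq ha hb]
  rcases max_choice b (Real.log (max |s| 1) / a) with h | h <;> rw [h]
  · exact le_mul_of_one_le_right (Real.exp_pos _).le h1
  · have h2 : Real.exp (T * (Real.log (max |s| 1) / a)) = (max |s| 1) ^ (T / a) := by
      rw [Real.rpow_def_of_pos (by positivity)]
      ring_nf
    rw [h2]
    calc (max |s| 1) ^ (T / a) ≤ (1 + |s|) ^ (T / a) := by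
          refine Real.rpow_le_rpow (by positivity) ?_ (by positivity)
          exact max_le (by linarith) (by linarith [abs_nonneg s])
      _ ≤ _ := le_mul_of_one_le_left (by positivity) (Real.one_le_exp (by positivity))

/-- The power `k` pays for three things: the growth `α`, the exponentials `e^((S+T) Re z)`, which
cost `(S + T) / a` powers, and two more powers for integrability in `s`. `S` comes from the support
and `T` is an extra exponential weight. -/
theorem rpow_mul_exp_mul_le (ha : 0 < a) (hb : 0 < b) {α S T K W v s : ℝ} {k : ℕ}
    (hST : 0 ≤ S + T) (hk : α + 2 + (S + T) / a ≤ k) (hW : 1 + |s| ≤ W) (hK : 0 ≤ K)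
    (hv : W ^ k * v ≤ K * Real.exp (S * (contour a b s).re)) :
    W ^ α * Real.exp (T * (contour a b s).re) * v ≤
      K * Real.exp ((S + T) * b) * (1 + s ^ 2)⁻¹ := by
  have hs1 : 1 ≤ 1 + |s| := by linarith [abs_nonneg s]
  have hW1 : 1 ≤ W := hs1.trans hW
  have hW0 : 0 < W := by linarith
  have hWk : 0 < W ^ k := by positivity
  have e1 : v ≤ K * Real.exp (S * (contour a b s).re) / W ^ k := by
    rw [le_div_iff₀ hWk]; linarith
  have e2 := exp_mul_contour_re_le ha hb hST s
  calc W ^ α * Real.exp (T * (contour a b s).re) * v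
      ≤ W ^ α * Real.exp (T * (contour a b s).re) *
        (K * Real.exp (S * (contour a b s).re) / W ^ k) := by gcongr
    _ = K * (W ^ α / W ^ k) * Real.exp ((S + T) * (contour a b s).re) := by
        rw [add_mul, Real.exp_add]; ring
    _ ≤ K * (W ^ α / W ^ k) * (Real.exp ((S + T) * b) * (1 + |s|) ^ ((S + T) / a)) := by gcongr
    _ ≤ K * (W ^ α / W ^ k) * (Real.exp ((S + T) * b) * W ^ ((S + T) / a)) := by gcongr
    _ = K * Real.exp ((S + T) * b) * W ^ (α + (S + T) / a - k) := by
        rw [Real.rpow_sub hW0, Real.rpow_add hW0, Real.rpow_natCast]; ring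
    _ ≤ K * Real.exp ((S + T) * b) * W ^ (-2 : ℝ) := by
        refine mul_le_mul_of_nonneg_left ?_ (by positivity)
        exact Real.rpow_le_rpow_of_exponent_le hW1 (by linarith)
    _ ≤ K * Real.exp ((S + T) * b) * (1 + s ^ 2)⁻¹ := by
        gcongr
        rw [Real.rpow_neg hW0.le]
        gcongr
        rw [Real.rpow_two]
        nlinarith [abs_nonneg s, sq_abs s]

theorem one_add_abs_le_one_add_norm_contour (a b s : ℝ) : 1 + |s| ≤ 1 + ‖contour a b s‖ := by
  have := Complex.abs_im_le_norm (contour a b s)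
  rw [contour_im] at this
  linarith

/-- The rapid decay of the transform of a test function along the contour. -/
theorem exists_laplace_contour_le (ha : 0 < a) (hb : 0 < b) {f : ℝ → ℂ} (hf : ContDiff ℝ ∞ f)
    (hc : HasCompactSupport f) (α : ℝ) {T : ℝ} (hT : 0 ≤ T) :
    ∃ K, ∀ s, (1 + ‖contour a b s‖) ^ α * Real.exp (T * (contour a b s).re) *
      ‖laplace f (contour a b s)‖ ≤ K * (1 + s ^ 2)⁻¹ := by
  obtain ⟨R, hR0, hR⟩ := exists_Icc_of_hasCompactSupport hc
  obtain ⟨k, hk⟩ := exists_nat_ge (α + 2 + (R + T) / a)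
  obtain ⟨K, hK0, hK⟩ := exists_norm_laplace_le hf (by linarith : -R ≤ R) hR k
  exact ⟨_, fun s => rpow_mul_exp_mul_le ha hb (by positivity) hk
    (one_add_abs_le_one_add_norm_contour a b s) hK0
    (hK _ (hb.le.trans (le_contour_re a b s)))⟩

theorem measurable_deriv_contour (a b : ℝ) : Measurable (deriv (contour a b)) := measurable_deriv _

/-- Integrability over the contour, with respect to `dz`, against a continuous density. -/
theorem integrable_deriv_contour_mul (ha : 0 < a) (hb : 0 < b) {g : ℝ → ℂ} (hg : Continuous g)
    {K : ℝ} (hK : ∀ s, ‖g s‖ ≤ K * (1 + s ^ 2)⁻¹) :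
    Integrable fun s => deriv (contour a b) s * g s := by
  refine (integrable_inv_one_add_sq.const_mul ((1 / a + 1) * K)).mono'
    ((measurable_deriv_contour a b).aestronglyMeasurable.mul hg.aestronglyMeasurable)
    (.of_forall fun s => ?_)
  rw [norm_mul, mul_assoc]
  exact mul_le_mul (norm_deriv_contour_le ha hb s) (hK s) (norm_nonneg _) (by positivity)

/-- Integration along a piece of the contour of a function with a primitive. -/
theorem intervalIntegral_deriv_contour_mul (ha : 0 < a) (hb : 0 < b) {g H : ℂ → ℂ} (ε : ℂ)
    (hH : ∀ s, HasDerivAt H (g (contour a b s + ε)) (contour a b s + ε))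
    (hi : Integrable fun s => deriv (contour a b) s * g (contour a b s + ε)) (u v : ℝ) :
    ∫ s in u..v, deriv (contour a b) s * g (contour a b s + ε) =
      H (contour a b v + ε) - H (contour a b u + ε) := by
  have hcont : Continuous fun s => H (contour a b s + ε) := by
    rw [continuous_iff_continuousAt]
    intro s
    exact ContinuousAt.comp (f := fun s => contour a b s + ε) (hH s).continuousAt
      ((continuous_contour ha hb).add continuous_const).continuousAt
  refine integral_eq_of_hasDerivAt_off_countable _ _
    (s := {Real.exp (a * b), -Real.exp (a * b)}) (Set.toFinite _).countable
    hcont.continuousOn (fun s hs => ?_) hi.intervalIntegrable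
  have h1 := ((differentiableAt_contour ha hb hs.2).hasDerivAt).add_const ε
  have := HasDerivAt.comp_of_eq (h₂ := H) s (hH s) h1 rfl
  rw [mul_comm]
  exact this

end Contour

/-! ### Cauchy's theorem and the inversion formula on the contour. -/

section Cauchy

variable {a b : ℝ}

theorem isOpen_openExpRegion (a b : ℝ) : IsOpen (openExpRegion a b) := by
  refine IsOpen.inter (isOpen_lt continuous_const Complex.continuous_re) ?_
  have h1 : Continuous fun z : ℂ => |z.im| := by fun_prop
  have h2 : Continuous fun z : ℂ => Real.exp (a * z.re) := by fun_prop
  exact isOpen_lt h1 h2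

theorem openExpRegion_subset (a b : ℝ) : openExpRegion a b ⊆ expRegion a b :=
  fun _ hz => ⟨hz.1.le, hz.2.le⟩

theorem add_mem_openExpRegion (ha : 0 < a) {z : ℂ} (hz : z ∈ openExpRegion a b) {t : ℝ}
    (ht : 0 ≤ t) : z + t ∈ openExpRegion a b := by
  obtain ⟨h1, h2⟩ := hz
  refine ⟨by simpa using by linarith, ?_⟩
  simp only [Complex.add_im, Complex.ofReal_im, add_zero, Complex.add_re, Complex.ofReal_re]
  exact h2.trans_le (Real.exp_le_exp.2 (by gcongr; linarith))

theorem add_mem_openExpRegion_of_pos (ha : 0 < a) {z : ℂ} (hz : z ∈ expRegion a b) {t : ℝ}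
    (ht : 0 < t) : z + t ∈ openExpRegion a b := by
  obtain ⟨h1, h2⟩ := hz
  refine ⟨by simpa using by linarith, ?_⟩
  simp only [Complex.add_im, Complex.ofReal_im, add_zero, Complex.add_re, Complex.ofReal_re]
  exact h2.trans_lt (Real.exp_lt_exp.2 (by gcongr; linarith))

/-- A rapidly decreasing holomorphic function on the region to the right of the contour has a
primitive which vanishes at infinity. -/
theorem exists_primitive_openExpRegion (ha : 0 < a) (hb : 0 < b) {g : ℂ → ℂ}
    (hg : DifferentiableOn ℂ g (openExpRegion a b)) {K : ℝ}
    (hK : ∀ z ∈ openExpRegion a b, ‖g z‖ ≤ K * ((1 + z.re ^ 2)⁻¹ * (1 + z.im ^ 2)⁻¹)) :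
    ∃ H : ℂ → ℂ, ∀ z ∈ openExpRegion a b, HasDerivAt H (g z) z ∧
      ‖H z‖ ≤ K * Real.pi * (1 + z.im ^ 2)⁻¹ := by
  set Ω := openExpRegion a b
  have hΩ : IsOpen Ω := isOpen_openExpRegion a b
  have hK0 : 0 ≤ K := by
    have h1 : ((b + 1 : ℝ) : ℂ) ∈ Ω := ⟨by simp, by simpa using Real.exp_pos _⟩
    have := (norm_nonneg _).trans (hK _ h1)
    exact nonneg_of_mul_nonneg_left this (by positivity)
  have hre {z : ℂ} (hz : z ∈ Ω) {t : ℝ} (ht : 0 ≤ t) :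
      ‖g (z + t)‖ ≤ K * (1 + z.im ^ 2)⁻¹ * (1 + t ^ 2)⁻¹ := by
    have hz0 : 0 < z.re := hb.trans hz.1
    refine (hK _ (add_mem_openExpRegion ha hz ht)).trans ?_
    simp only [Complex.add_im, Complex.ofReal_im, add_zero, Complex.add_re, Complex.ofReal_re]
    rw [mul_assoc, mul_comm (1 + z.im ^ 2)⁻¹]
    gcongr
    linarith
  have hre' {z : ℂ} (hz : z ∈ Ω) {t : ℝ} (ht : 0 ≤ t) : ‖g (z + t)‖ ≤ K * (1 + t ^ 2)⁻¹ := by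
    refine (hre hz ht).trans ?_
    gcongr
    refine mul_le_of_le_one_right hK0 (inv_le_one_of_one_le₀ ?_)
    nlinarith [sq_nonneg z.im]
  have hcont {f : ℂ → ℂ} (hf : ContinuousOn f Ω) {z : ℂ} (hz : z ∈ Ω) :
      ContinuousOn (fun t : ℝ => f (z + t)) (Ici 0) :=
    hf.comp (by fun_prop) fun t ht => add_mem_openExpRegion ha hz ht
  have hmeas {f : ℂ → ℂ} (hf : ContinuousOn f Ω) {z : ℂ} (hz : z ∈ Ω) :
      AEStronglyMeasurable (fun t : ℝ => f (z + t)) (volume.restrict (Ioi 0)) :=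
    ((hcont hf hz).mono Ioi_subset_Ici_self).aestronglyMeasurable measurableSet_Ioi
  have hgi {z : ℂ} (hz : z ∈ Ω) : IntegrableOn (fun t : ℝ => g (z + t)) (Ioi 0) := by
    refine (integrable_inv_one_add_sq.integrableOn.const_mul K).mono' (hmeas hg.continuousOn hz) ?_
    filter_upwards [ae_restrict_mem measurableSet_Ioi] with t ht using hre' hz (le_of_lt ht)
  -- The primitive is the integral along the horizontal ray to the right, which never leaves the
  -- region.
  refine ⟨fun z => -∫ t in Ioi (0 : ℝ), g (z + t), fun z hz => ⟨?_, ?_⟩⟩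
  · obtain ⟨δ, hδ0, hδ⟩ := Metric.isOpen_iff.1 hΩ z hz
    have hd : ContinuousOn (deriv g) Ω := (hg.deriv hΩ).continuousOn
    have hball : ∀ w ∈ Metric.ball z (δ / 2), w ∈ Ω := fun w hw =>
      hδ (Metric.ball_subset_ball (by linarith) hw)
    have hder (w : ℂ) (hw : w ∈ Ω) (t : ℝ) (ht : 0 ≤ t) : HasDerivAt g (deriv g (w + t)) (w + t) :=
      (hg.differentiableAt (hΩ.mem_nhds (add_mem_openExpRegion ha hw ht))).hasDerivAt
    -- Cauchy's estimate on discs of radius `δ / 4`: with `w` within `δ / 2` of `z`, the disc stays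
    -- in a rightward translate of the `δ`-ball, and the decay in `t` passes to the derivative.
    have hbound : ∀ t : ℝ, 0 ≤ t → ∀ w ∈ Metric.ball z (δ / 2),
        ‖deriv g (w + t)‖ ≤ K / (δ / 4) * (1 + t ^ 2)⁻¹ := by
      intro t ht w hw
      have hsub : Metric.closedBall (w + t) (δ / 4) ⊆ Ω := by
        intro v hv
        have h1 : v - t ∈ Ω := by
          refine hδ ?_
          rw [Metric.mem_ball, dist_eq_norm] at hw ⊢
          rw [Metric.mem_closedBall, dist_eq_norm] at hv
          have := norm_add_le (v - (w + t)) (w - z)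
          have h2 : v - t - z = v - (w + t) + (w - z) := by ring
          rw [h2]
          linarith
        simpa using add_mem_openExpRegion ha h1 ht
      have h3 : DiffContOnCl ℂ g (Metric.ball (w + t) (δ / 4)) := by
        refine (hg.mono ?_).diffContOnCl
        rw [closure_ball _ (by positivity)]
        exact hsub
      have := Complex.norm_deriv_le_of_forall_mem_sphere_norm_le (by positivity) h3
        (C := K * (1 + t ^ 2)⁻¹) (fun v hv => by
          have h1 : v - t ∈ Ω := by
            refine hδ ?_
            rw [Metric.mem_ball, dist_eq_norm] at hw ⊢
            rw [mem_sphere_iff_norm] at hv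
            have := norm_add_le (v - (w + t)) (w - z)
            have h2 : v - t - z = v - (w + t) + (w - z) := by ring
            rw [h2]
            linarith
          have := hre' h1 ht
          rwa [sub_add_cancel] at this)
      refine this.trans (le_of_eq ?_)
      ring
    have h := hasDerivAt_integral_of_dominated_loc_of_deriv_le
      (μ := volume.restrict (Ioi (0 : ℝ))) (F := fun (w : ℂ) (t : ℝ) => g (w + t))
      (F' := fun (w : ℂ) (t : ℝ) => deriv g (w + t)) (x₀ := z)
      (bound := fun t : ℝ => K / (δ / 4) * (1 + t ^ 2)⁻¹)
      (Metric.ball_mem_nhds z (half_pos hδ0))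
      (by filter_upwards [Metric.ball_mem_nhds z (half_pos hδ0)] with w hw using
        hmeas hg.continuousOn (hball w hw))
      (hgi hz) (hmeas hd hz)
      (by filter_upwards [ae_restrict_mem measurableSet_Ioi] with t ht using hbound t (le_of_lt ht))
      (integrable_inv_one_add_sq.integrableOn.const_mul _)
      (by
        filter_upwards [ae_restrict_mem measurableSet_Ioi] with t ht w hw
        exact (hder w (hball w hw) t (le_of_lt ht)).comp_add_const w t)
    -- The integrand is the `t`-derivative of `g (z + t)`, which vanishes at infinity, so only the
    -- value at `t = 0` remains.
    have hval : ∫ t in Ioi (0 : ℝ), deriv g (z + t) = 0 - g (z + (0 : ℝ)) := by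
      refine integral_Ioi_of_hasDerivAt_of_tendsto' (f := fun t : ℝ => g (z + t)) ?_ h.1 ?_
      · intro t ht
        have := (hder z hz t ht).comp_const_add z t
        exact this.comp_ofReal
      · refine squeeze_zero_norm' (a := fun t : ℝ => K * (1 + t ^ 2)⁻¹) ?_ ?_
        · filter_upwards [eventually_ge_atTop 0] with t ht using hre' hz ht
        · rw [← mul_zero K]
          refine Tendsto.const_mul K (tendsto_inv_atTop_zero.comp ?_)
          exact tendsto_atTop_add_const_left _ _ (tendsto_pow_atTop two_ne_zero)
    have := h.2.neg
    rwa [hval, zero_sub, neg_neg, Complex.ofReal_zero, add_zero] at this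
  · rw [norm_neg]
    refine (norm_integral_le_of_norm_le
      (g := fun t : ℝ => K * (1 + z.im ^ 2)⁻¹ * (1 + t ^ 2)⁻¹)
      (integrable_inv_one_add_sq.integrableOn.const_mul _) ?_).trans ?_
    · filter_upwards [ae_restrict_mem measurableSet_Ioi] with t ht using hre hz (le_of_lt ht)
    · rw [integral_const_mul]
      calc K * (1 + z.im ^ 2)⁻¹ * ∫ t in Ioi (0 : ℝ), (1 + t ^ 2)⁻¹
          ≤ K * (1 + z.im ^ 2)⁻¹ * ∫ t : ℝ, (1 + t ^ 2)⁻¹ := by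
            refine mul_le_mul_of_nonneg_left (setIntegral_le_integral integrable_inv_one_add_sq
              (.of_forall fun t => ?_)) (by positivity)
            simp only [Pi.zero_apply]
            positivity
        _ = K * Real.pi * (1 + z.im ^ 2)⁻¹ := by rw [integral_univ_inv_one_add_sq]; ring

theorem tendsto_inv_one_add_natCast_sq :
    Tendsto (fun n : ℕ => (1 + (n : ℝ) ^ 2)⁻¹) atTop (𝓝 0) :=
  tendsto_inv_atTop_zero.comp (tendsto_atTop_add_const_left _ _
    ((tendsto_pow_atTop two_ne_zero).comp tendsto_natCast_atTop_atTop))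

theorem tendsto_intervalIntegral_natCast {f : ℝ → ℂ} (hf : Integrable f) :
    Tendsto (fun n : ℕ => ∫ s in (-(n : ℝ))..n, f s) atTop (𝓝 (∫ s, f s)) :=
  intervalIntegral_tendsto_integral hf
    (tendsto_neg_atTop_atBot.comp tendsto_natCast_atTop_atTop) tendsto_natCast_atTop_atTop

/-- Cauchy's theorem for the region to the right of the contour. -/
theorem integral_contour_eq_zero (ha : 0 < a) (hb : 0 < b) {g : ℂ → ℂ}
    (hg : DifferentiableOn ℂ g (openExpRegion a b)) (hgc : ContinuousOn g (expRegion a b)) {K : ℝ}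
    (hK : ∀ z ∈ expRegion a b, ‖g z‖ ≤ K * ((1 + z.re ^ 2)⁻¹ * (1 + z.im ^ 2)⁻¹)) :
    ∫ s, deriv (contour a b) s * g (contour a b s) = 0 := by
  obtain ⟨H, hH⟩ := exists_primitive_openExpRegion ha hb hg
    fun z hz => hK z (openExpRegion_subset a b hz)
  have hK0 : 0 ≤ K := by
    have := (norm_nonneg _).trans (hK _ (contour_mem_expRegion ha b 0))
    exact nonneg_of_mul_nonneg_left this (by positivity)
  have hmem (s : ℝ) {ε : ℝ} (hε : 0 < ε) : contour a b s + ε ∈ openExpRegion a b :=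
    add_mem_openExpRegion_of_pos ha (contour_mem_expRegion ha b s) hε
  have hbd (s : ℝ) {ε : ℝ} (hε : 0 < ε) : ‖g (contour a b s + ε)‖ ≤ K * (1 + s ^ 2)⁻¹ := by
    refine (hK _ (openExpRegion_subset a b (hmem s hε))).trans ?_
    gcongr
    have h1 : (contour a b s + ε).im = s := by simp
    rw [h1]
    exact mul_le_of_le_one_left (by positivity)
      (inv_le_one_of_one_le₀ (le_add_of_nonneg_right (sq_nonneg _)))
  have hcont {ε : ℝ} (hε : 0 < ε) : Continuous fun s => g (contour a b s + ε) :=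
    hgc.comp_continuous ((continuous_contour ha hb).add continuous_const)
      fun s => openExpRegion_subset a b (hmem s hε)
  -- The contour lies on the boundary, where no primitive is available. Shifted right by `ε` it lies
  -- in the open region, and the truncated integrals are differences of `H` at the ends, which tend
  -- to zero. Continuity up to the boundary then allows `ε → 0`.
  have hshift {ε : ℝ} (hε : 0 < ε) :
      ∫ s, deriv (contour a b) s * g (contour a b s + ε) = 0 := by
    have hi := integrable_deriv_contour_mul ha hb (hcont hε) fun s => hbd s hε
    refine tendsto_nhds_unique (tendsto_intervalIntegral_natCast hi) ?_
    refine squeeze_zero_norm (a := fun n : ℕ => K * Real.pi * (1 + (n : ℝ) ^ 2)⁻¹ +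
      K * Real.pi * (1 + (n : ℝ) ^ 2)⁻¹) (fun n => ?_) ?_
    · rw [intervalIntegral_deriv_contour_mul ha hb ε (fun s => (hH _ (hmem s hε)).1) hi]
      refine (norm_sub_le _ _).trans (add_le_add ?_ ?_)
      · simpa using (hH _ (hmem n hε)).2
      · simpa using (hH _ (hmem (-n) hε)).2
    · simpa using (tendsto_inv_one_add_natCast_sq.const_mul (K * Real.pi)).add
        (tendsto_inv_one_add_natCast_sq.const_mul (K * Real.pi))
  have hlim : Tendsto (fun n : ℕ => ∫ s, deriv (contour a b) s *
      g (contour a b s + ((1 / ((n : ℝ) + 1) : ℝ) : ℂ))) atTop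
      (𝓝 (∫ s, deriv (contour a b) s * g (contour a b s))) := by
    refine tendsto_integral_of_dominated_convergence
      (fun s => (1 / a + 1) * K * (1 + s ^ 2)⁻¹)
      (fun n => (integrable_deriv_contour_mul ha hb (hcont Nat.one_div_pos_of_nat)
        fun s => hbd s Nat.one_div_pos_of_nat).aestronglyMeasurable)
      (integrable_inv_one_add_sq.const_mul _) (fun n => .of_forall fun s => ?_)
      (.of_forall fun s => ?_)
    · rw [norm_mul, mul_assoc]
      exact mul_le_mul (norm_deriv_contour_le ha hb s) (hbd s Nat.one_div_pos_of_nat)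
        (norm_nonneg _) (by positivity)
    · refine Tendsto.const_mul _ ?_
      have h1 : Tendsto (fun n : ℕ => contour a b s + ((1 / ((n : ℝ) + 1) : ℝ) : ℂ)) atTop
          (𝓝[expRegion a b] (contour a b s)) := by
        refine tendsto_nhdsWithin_iff.2 ⟨?_, .of_forall fun n =>
          openExpRegion_subset a b (hmem s Nat.one_div_pos_of_nat)⟩
        have h2 := (Complex.continuous_ofReal.tendsto 0).comp
          (tendsto_one_div_add_atTop_nhds_zero_nat (𝕜 := ℝ))
        simpa [Function.comp_def] using h2.const_add (contour a b s)
      exact (hgc _ (contour_mem_expRegion ha b s)).tendsto.comp h1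
  refine tendsto_nhds_unique hlim ?_
  simp only [hshift Nat.one_div_pos_of_nat]
  exact tendsto_const_nhds

/-- The contour integral of the transform of a test function `f` is `i f(0)`. -/
theorem integral_contour_laplace (ha : 0 < a) (hb : 0 < b) {f : ℝ → ℂ} (hf : ContDiff ℝ ∞ f)
    (hc : HasCompactSupport f) :
    ∫ s, deriv (contour a b) s * laplace f (contour a b s) = Complex.I * f 0 := by
  have hd := differentiable_laplace hf.continuous hc
  -- The transform is entire, so truncated integrals over the contour and over the imaginary axis
  -- depend only on endpoints. Endpoints at equal height `s` are joined by a horizontal segment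
  -- along which `H` varies little.
  obtain ⟨H, hH⟩ := hd.isExactOn_univ
  obtain ⟨R, hR0, hR⟩ := exists_Icc_of_hasCompactSupport hc
  -- The `1` added to `R` is an exponential weight covering the segment length, via `X ≤ e^X`; the
  -- `0` is the growth exponent.
  obtain ⟨k, hk⟩ := exists_nat_ge (0 + 2 + (R + 1) / a)
  obtain ⟨K, hK0, hK⟩ := exists_norm_laplace_le hf (by linarith : -R ≤ R) hR k
  obtain ⟨hint, hval⟩ := integral_laplace_I hf hc
  have hseg (s : ℝ) : ‖H (contour a b s) - H (s * Complex.I)‖ ≤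
      K * Real.exp ((R + 1) * b) * (1 + s ^ 2)⁻¹ := by
    set X := (contour a b s).re
    have hX0 : 0 < X := hb.trans_le (le_contour_re a b s)
    set S : Set ℂ := {z | z.re ∈ Icc 0 X ∧ z.im = s}
    have hS : Convex ℝ S := ((convex_Icc (0 : ℝ) X).is_linear_preimage
      Complex.reLm.isLinear).inter ((convex_singleton s).is_linear_preimage Complex.imLm.isLinear)
    have hbS : ∀ z ∈ S, ‖laplace f z‖ ≤ K * Real.exp (R * X) / (1 + |s|) ^ k := by
      rintro z ⟨hz1, hz2⟩
      rw [le_div_iff₀ (by positivity), mul_comm]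
      calc (1 + |s|) ^ k * ‖laplace f z‖ ≤ (1 + ‖z‖) ^ k * ‖laplace f z‖ := by
            gcongr
            rw [← hz2]
            exact Complex.abs_im_le_norm z
        _ ≤ K * Real.exp (R * z.re) := hK z hz1.1
        _ ≤ _ := by gcongr; exact hz1.2
    have h1 := hS.norm_image_sub_le_of_norm_hasDerivWithin_le
      (fun z _ => (hH z (mem_univ z)).hasDerivWithinAt) hbS
      (x := s * Complex.I) (y := contour a b s) (by simp [S, hX0.le])
      ⟨⟨hX0.le, le_rfl⟩, rfl⟩
    have h2 : ‖contour a b s - s * Complex.I‖ = X := by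
      have : contour a b s - s * Complex.I = (X : ℂ) := by
        apply Complex.ext <;> simp [X]
      rw [this, Complex.norm_real, Real.norm_of_nonneg hX0.le]
    rw [h2] at h1
    refine h1.trans ?_
    have h3 := rpow_mul_exp_mul_le ha hb (α := 0) (S := R) (T := 1) (s := s) (W := 1 + |s|)
      (v := K * Real.exp (R * X) / (1 + |s|) ^ k) (by linarith) hk le_rfl hK0
      (le_of_eq (by field_simp; rfl))
    rw [Real.rpow_zero, one_mul, one_mul] at h3
    refine le_trans ?_ h3
    rw [mul_comm]
    gcongr
    linarith [Real.add_one_le_exp X]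
  have hi : Integrable fun s => deriv (contour a b) s * laplace f (contour a b s) := by
    obtain ⟨K', hK'⟩ := exists_laplace_contour_le ha hb hf hc 0 le_rfl
    exact integrable_deriv_contour_mul ha hb (hd.continuous.comp (continuous_contour ha hb))
      fun s => by simpa using hK' s
  have h1 := tendsto_intervalIntegral_natCast hi
  have h2 := tendsto_intervalIntegral_natCast (hint.const_mul Complex.I)
  rw [integral_const_mul, hval] at h2
  refine tendsto_nhds_unique h1 ?_
  rw [← zero_add (Complex.I * f 0)]
  refine Tendsto.congr (fun n => sub_add_cancel _ _) (Tendsto.add ?_ h2)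
  set B := K * Real.exp ((R + 1) * b)
  refine squeeze_zero_norm (a := fun n : ℕ => B * (1 + (n : ℝ) ^ 2)⁻¹ +
      B * (1 + (n : ℝ) ^ 2)⁻¹) (fun n => ?_) ?_
  · have e1 := intervalIntegral_deriv_contour_mul ha hb (g := laplace f) 0
      (fun s => hH _ (mem_univ _)) (by simpa using hi) (-(n : ℝ)) n
    have e2 : ∫ s in (-(n : ℝ))..n, Complex.I * laplace f (s * Complex.I) =
        H ((n : ℝ) * Complex.I) - H ((-(n : ℝ) : ℝ) * Complex.I) := by
      refine intervalIntegral.integral_eq_sub_of_hasDerivAt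
        (f := fun s : ℝ => H (s * Complex.I)) (fun s _ => ?_)
        (hint.const_mul Complex.I).intervalIntegrable
      have h3 : HasDerivAt (fun s : ℝ => (s : ℂ) * Complex.I) Complex.I s := by
        simpa using (hasDerivAt_id s).ofReal_comp.mul_const Complex.I
      have := HasDerivAt.comp s (hH (s * Complex.I) (mem_univ _)) h3
      rw [mul_comm]
      exact this
    simp only [add_zero] at e1
    rw [e1, e2, sub_sub_sub_comm]
    refine (norm_sub_le _ _).trans (add_le_add (hseg n) ?_)
    simpa using hseg (-n)
  · simpa using (tendsto_inv_one_add_natCast_sq.const_mul B).add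
      (tendsto_inv_one_add_natCast_sq.const_mul B)

end Cauchy

/-! ### Pairing transforms with slowly growing functions; the resolvent equation. -/

section ScalarContour

variable {a b α : ℝ}

/-- Scalar functions on `E(a, b)`, holomorphic inside, of growth `O(|z|^α)`. -/
structure IsSlowlyGrowing (a b α : ℝ) (g : ℂ → ℂ) : Prop where
  differentiableOn : DifferentiableOn ℂ g (openExpRegion a b)
  continuousOn : ContinuousOn g (expRegion a b)
  exists_bound : ∃ B, 0 ≤ B ∧ ∀ z ∈ expRegion a b, ‖g z‖ ≤ B * (1 + ‖z‖) ^ α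

/-- The contour integral of the product of the transform of `f` with `g`. -/
noncomputable def contourPairing (a b : ℝ) (f : ℝ → ℂ) (g : ℂ → ℂ) : ℂ :=
  ∫ s, deriv (contour a b) s * (laplace f (contour a b s) * g (contour a b s))

theorem IsSlowlyGrowing.continuous_comp_contour {g : ℂ → ℂ} (hg : IsSlowlyGrowing a b α g)
    (ha : 0 < a) (hb : 0 < b) : Continuous fun s => g (contour a b s) :=
  hg.continuousOn.comp_continuous (continuous_contour ha hb) (contour_mem_expRegion ha b)

theorem continuous_laplace_contour (ha : 0 < a) (hb : 0 < b) {f : ℝ → ℂ} (hf : Continuous f)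
    (hc : HasCompactSupport f) : Continuous fun s => laplace f (contour a b s) :=
  (differentiable_laplace hf hc).continuous.comp (continuous_contour ha hb)

theorem IsSlowlyGrowing.exists_laplace_mul_le {g : ℂ → ℂ} (hg : IsSlowlyGrowing a b α g)
    (ha : 0 < a) (hb : 0 < b) {f : ℝ → ℂ} (hf : ContDiff ℝ ∞ f) (hc : HasCompactSupport f)
    {T : ℝ} (hT : 0 ≤ T) :
    ∃ K, ∀ s, Real.exp (T * (contour a b s).re) *
      ‖laplace f (contour a b s) * g (contour a b s)‖ ≤ K * (1 + s ^ 2)⁻¹ := by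
  obtain ⟨K, hK⟩ := exists_laplace_contour_le ha hb hf hc α hT
  obtain ⟨B, hB0, hB⟩ := hg.exists_bound
  refine ⟨B * K, fun s => ?_⟩
  rw [norm_mul]
  calc _ ≤ Real.exp (T * (contour a b s).re) * (‖laplace f (contour a b s)‖ *
        (B * (1 + ‖contour a b s‖) ^ α)) := by
        gcongr
        exact hB _ (contour_mem_expRegion ha b s)
    _ = B * ((1 + ‖contour a b s‖) ^ α * Real.exp (T * (contour a b s).re) *
      ‖laplace f (contour a b s)‖) := by ring
    _ ≤ B * (K * (1 + s ^ 2)⁻¹) := mul_le_mul_of_nonneg_left (hK s) hB0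
    _ = _ := by ring

theorem IsSlowlyGrowing.integrable {g : ℂ → ℂ} (hg : IsSlowlyGrowing a b α g)
    (ha : 0 < a) (hb : 0 < b) {f : ℝ → ℂ} (hf : ContDiff ℝ ∞ f) (hc : HasCompactSupport f) :
    Integrable fun s => deriv (contour a b) s *
      (laplace f (contour a b s) * g (contour a b s)) := by
  obtain ⟨K, hK⟩ := hg.exists_laplace_mul_le ha hb hf hc le_rfl
  exact integrable_deriv_contour_mul ha hb
    ((continuous_laplace_contour ha hb hf.continuous hc).mul (hg.continuous_comp_contour ha hb))
    fun s => by simpa using hK s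

/-- The pairing vanishes for test functions supported in the negative half line. -/
theorem IsSlowlyGrowing.contourPairing_eq_zero {g : ℂ → ℂ} (hg : IsSlowlyGrowing a b α g)
    (ha : 0 < a) (hb : 0 < b) {f : ℝ → ℂ} (hf : ContDiff ℝ ∞ f) (hc : HasCompactSupport f)
    (hs : ∀ t, 0 < t → f t = 0) : contourPairing a b f g = 0 := by
  obtain ⟨R, hR0, hR⟩ := exists_Icc_of_hasCompactSupport hc
  obtain ⟨B, hB0, hB⟩ := hg.exists_bound
  -- After absorbing `α`, two powers give decay in the real part and two in the imaginary part.
  obtain ⟨k, hk⟩ := exists_nat_ge (α + 4)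
  have hR' : ∀ t, t ∉ Icc (-R) 0 → f t = 0 := by
    intro t ht
    rcases le_or_gt t 0 with h | h
    · exact hR t fun h' => ht ⟨h'.1, h⟩
    · exact hs t h
  obtain ⟨K, hK0, hK⟩ := exists_norm_laplace_le hf (by linarith : -R ≤ 0) hR' k
  refine integral_contour_eq_zero ha hb (g := fun z => laplace f z * g z) (K := K * B)
    ((differentiable_laplace hf.continuous hc).differentiableOn.mul hg.differentiableOn)
    ((differentiable_laplace hf.continuous hc).continuous.continuousOn.mul hg.continuousOn)
    fun z hz => ?_
  have h1 := hK z (hb.le.trans hz.1)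
  rw [zero_mul, Real.exp_zero, mul_one] at h1
  set W := 1 + ‖z‖
  have hW1 : 1 ≤ W := le_add_of_nonneg_right (norm_nonneg z)
  have hW0 : 0 < W := by linarith
  have h2 : ‖laplace f z‖ ≤ K / W ^ k := by
    rw [le_div_iff₀ (by positivity), mul_comm]
    exact h1
  have h3 (x : ℝ) (hx : |x| ≤ ‖z‖) : 1 + x ^ 2 ≤ W ^ 2 := by
    simp only [W]
    nlinarith [abs_nonneg x, sq_abs x]
  calc ‖laplace f z * g z‖ ≤ K / W ^ k * (B * W ^ α) := by
        rw [norm_mul]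
        gcongr
        exact hB z hz
    _ = K * B * W ^ (α - k) := by rw [Real.rpow_sub hW0, Real.rpow_natCast]; ring
    _ ≤ K * B * W ^ (-4 : ℝ) := by
        refine mul_le_mul_of_nonneg_left ?_ (by positivity)
        exact Real.rpow_le_rpow_of_exponent_le hW1 (by linarith)
    _ = K * B * ((W ^ 2)⁻¹ * (W ^ 2)⁻¹) := by
        rw [Real.rpow_neg hW0.le, ← mul_inv, ← pow_add]
        norm_cast
    _ ≤ _ := by
        gcongr
        · exact h3 _ (Complex.abs_re_le_norm z)
        · exact h3 _ (Complex.abs_im_le_norm z)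

/-- Fubini's theorem for a contour integral and an integral over a bounded interval. -/
theorem integral_contour_intervalIntegral_swap (ha : 0 < a) (hb : 0 < b) {P : ℝ → ℂ}
    (hP : Continuous P) {T K : ℝ} (hT : 0 ≤ T)
    (hK : ∀ s, Real.exp (T * (contour a b s).re) * ‖P s‖ ≤ K * (1 + s ^ 2)⁻¹)
    {q : ℝ → ℂ} (hq : ContinuousOn q (Icc 0 T)) {c : ℝ} (hc : c ≤ 1) :
    Integrable (fun s => deriv (contour a b) s * (P s *
        ∫ σ in (0 : ℝ)..T, q σ * Complex.exp (contour a b s * (c * σ : ℝ)))) ∧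
    ∫ s, deriv (contour a b) s * (P s *
        ∫ σ in (0 : ℝ)..T, q σ * Complex.exp (contour a b s * (c * σ : ℝ))) =
      ∫ σ in (0 : ℝ)..T, q σ * ∫ s, deriv (contour a b) s *
        (P s * Complex.exp (contour a b s * (c * σ : ℝ))) := by
  obtain ⟨Q, hQ⟩ := isCompact_Icc.exists_bound_of_continuousOn hq
  set ν := (volume : Measure ℝ).restrict (Ioc 0 T)
  have hγ := continuous_contour ha hb
  have hQ' : ∀ᵐ σ ∂ν, 0 ≤ σ ∧ σ ≤ T ∧ ‖q σ‖ ≤ Q := by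
    filter_upwards [ae_restrict_mem measurableSet_Ioc] with σ hσ
    exact ⟨hσ.1.le, hσ.2, hQ σ ⟨hσ.1.le, hσ.2⟩⟩
  have hint : Integrable (fun p : ℝ × ℝ => deriv (contour a b) p.1 *
      (P p.1 * (q p.2 * Complex.exp (contour a b p.1 * (c * p.2 : ℝ)))))
      ((volume : Measure ℝ).prod ν) := by
    have hdom : Integrable (fun p : ℝ × ℝ => (1 / a + 1) * K * (1 + p.1 ^ 2)⁻¹ * Q)
        ((volume : Measure ℝ).prod ν) :=
      (integrable_inv_one_add_sq.const_mul _).mul_prod (integrable_const Q)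
    refine hdom.mono' ?_ ?_
    · have h1 : AEStronglyMeasurable (fun p : ℝ × ℝ => deriv (contour a b) p.1)
          ((volume : Measure ℝ).prod ν) :=
        ((measurable_deriv_contour a b).comp measurable_fst).aestronglyMeasurable
      have h2 : AEStronglyMeasurable (fun p : ℝ × ℝ => P p.1) ((volume : Measure ℝ).prod ν) :=
        (hP.comp continuous_fst).aestronglyMeasurable
      have h3 : AEStronglyMeasurable (fun p : ℝ × ℝ => q p.2) ((volume : Measure ℝ).prod ν) :=
        ((hq.mono Ioc_subset_Icc_self).aestronglyMeasurable measurableSet_Ioc).comp_snd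
      have h4 : AEStronglyMeasurable (fun p : ℝ × ℝ =>
          Complex.exp (contour a b p.1 * (c * p.2 : ℝ))) ((volume : Measure ℝ).prod ν) :=
        Continuous.aestronglyMeasurable (by fun_prop)
      exact h1.mul (h2.mul (h3.mul h4))
    · have hsnd : ∀ᵐ p ∂((volume : Measure ℝ).prod ν), 0 ≤ p.2 ∧ p.2 ≤ T ∧ ‖q p.2‖ ≤ Q :=
        Measure.quasiMeasurePreserving_snd.ae hQ'
      filter_upwards [hsnd] with p hp
      obtain ⟨h0, hpT, hpq⟩ := hp
      have hre : 0 ≤ (contour a b p.1).re := hb.le.trans (le_contour_re a b p.1)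
      -- Only `c * σ ≤ T` matters, so the cases `c = 1` and `c = -1` are treated together.
      have e1 : ‖Complex.exp (contour a b p.1 * (c * p.2 : ℝ))‖ ≤
          Real.exp (T * (contour a b p.1).re) := by
        rw [Complex.norm_exp, Real.exp_le_exp, Complex.re_mul_ofReal, mul_comm]
        gcongr
        nlinarith
      calc _ = ‖deriv (contour a b) p.1‖ * (‖P p.1‖ * (‖q p.2‖ *
            ‖Complex.exp (contour a b p.1 * (c * p.2 : ℝ))‖)) := by simp only [norm_mul]
        _ ≤ (1 / a + 1) * (‖P p.1‖ * (Q * Real.exp (T * (contour a b p.1).re))) := by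
            gcongr
            · exact norm_deriv_contour_le ha hb _
            · exact (norm_nonneg _).trans hpq
        _ = (1 / a + 1) * (Real.exp (T * (contour a b p.1).re) * ‖P p.1‖) * Q := by ring
        _ ≤ (1 / a + 1) * (K * (1 + p.1 ^ 2)⁻¹) * Q := by
            refine mul_le_mul_of_nonneg_right (mul_le_mul_of_nonneg_left (hK p.1) (by positivity)) ?_
            exact (norm_nonneg _).trans hpq
        _ = _ := by ring
  have := integral_integral_swap (f := fun s σ => deriv (contour a b) s *
      (P s * (q σ * Complex.exp (contour a b s * (c * σ : ℝ))))) hint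
  simp only [intervalIntegral.integral_of_le hT]
  refine ⟨?_, ?_⟩
  · have h1 := hint.integral_prod_left
    simp only [integral_const_mul] at h1
    exact h1
  calc _ = ∫ s, ∫ σ, deriv (contour a b) s *
      (P s * (q σ * Complex.exp (contour a b s * (c * σ : ℝ)))) ∂ν := by
        simp only [integral_const_mul]
        rfl
    _ = _ := this
    _ = _ := by
        congr 1
        funext σ
        rw [← integral_const_mul]
        congr 1
        funext s
        ring

theorem contourPairing_comp_add (f : ℝ → ℂ) (g : ℂ → ℂ) (σ : ℝ) :
    contourPairing a b (fun t => f (t + σ)) g =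
      ∫ s, deriv (contour a b) s * (laplace f (contour a b s) * g (contour a b s) *
        Complex.exp (contour a b s * (-1 * σ : ℝ))) := by
  rw [contourPairing]
  congr 1
  funext s
  rw [laplace_comp_add]
  push_cast
  ring_nf

theorem contDiff_comp_add {f : ℝ → ℂ} (hf : ContDiff ℝ ∞ f) (σ : ℝ) :
    ContDiff ℝ ∞ fun t => f (t + σ) := hf.comp (contDiff_id.add contDiff_const)

theorem hasCompactSupport_comp_add {f : ℝ → ℂ} (hc : HasCompactSupport f) (σ : ℝ) :
    HasCompactSupport fun t => f (t + σ) := hc.comp_homeomorph (Homeomorph.addRight σ)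

theorem integral_contour_laplace_mul_exp (ha : 0 < a) (hb : 0 < b) {f : ℝ → ℂ}
    (hf : ContDiff ℝ ∞ f) (hc : HasCompactSupport f) (c σ : ℝ) :
    ∫ s, deriv (contour a b) s * (laplace f (contour a b s) *
      Complex.exp (contour a b s * (c * σ : ℝ))) = Complex.I * f (-(c * σ)) := by
  have := integral_contour_laplace ha hb (contDiff_comp_add hf (-(c * σ)))
    (hasCompactSupport_comp_add hc (-(c * σ)))
  rw [zero_add] at this
  rw [← this]
  congr 1
  funext s
  rw [laplace_comp_add]
  push_cast
  ring_nf

/-- Translation by `σ ≥ 0` multiplies the transform by `e^(-zσ)`, of modulus at most one on the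
contour, so the untranslated integrand is a majorant. This makes the pairing an admissible density
`q` in the Fubini lemma. -/
theorem IsSlowlyGrowing.continuousOn_contourPairing_comp_add {g : ℂ → ℂ}
    (hg : IsSlowlyGrowing a b α g) (ha : 0 < a) (hb : 0 < b) {f : ℝ → ℂ} (hf : ContDiff ℝ ∞ f)
    (hc : HasCompactSupport f) :
    ContinuousOn (fun σ : ℝ => contourPairing a b (fun t => f (t + σ)) g) (Ici 0) := by
  simp only [contourPairing_comp_add]
  have hγ := continuous_contour ha hb
  have h1 := continuous_laplace_contour ha hb hf.continuous hc
  have h2 := hg.continuous_comp_contour ha hb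
  refine continuousOn_of_dominated
    (bound := fun s => ‖deriv (contour a b) s * (laplace f (contour a b s) * g (contour a b s))‖)
    (fun σ _ => ?_) (fun σ hσ => .of_forall fun s => ?_) (hg.integrable ha hb hf hc).norm
    (.of_forall fun s => ?_)
  · exact (measurable_deriv_contour a b).aestronglyMeasurable.mul
      ((h1.mul h2).mul (by fun_prop)).aestronglyMeasurable
  · rw [← mul_assoc, norm_mul]
    refine mul_le_of_le_one_right (norm_nonneg _) ?_
    rw [Complex.norm_exp, Real.exp_le_one_iff, Complex.re_mul_ofReal]
    have hre : 0 ≤ (contour a b s).re := hb.le.trans (le_contour_re a b s)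
    have : (0 : ℝ) ≤ σ := hσ
    nlinarith [mul_nonneg hre this]
  · exact Continuous.continuousOn (by fun_prop)

/-- The resolvent equation `(w - z) k(w) = g(z) - g(w)`, integrated over the contour. -/
theorem contourPairing_resolvent (ha : 0 < a) (hb : 0 < b) {f : ℝ → ℂ} (hf : ContDiff ℝ ∞ f)
    {T : ℝ} (hT : 0 ≤ T) (hfT : ∀ t, t ∉ Icc (-T) T → f t = 0) {g k : ℂ → ℂ}
    (hg : IsSlowlyGrowing a b α g) (hk : IsSlowlyGrowing a b α k) (z : ℂ)
    (hres : ∀ w ∈ expRegion a b, (w - z) * k w = g z - g w) :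
    contourPairing a b f k = ∫ σ in (0 : ℝ)..T, Complex.exp (z * σ) *
      (Complex.I * f σ * g z - contourPairing a b (fun t => f (t + σ)) g) := by
  have hc : HasCompactSupport f := HasCompactSupport.intro isCompact_Icc hfT
  have hlf := continuous_laplace_contour ha hb hf.continuous hc
  -- Translation by `T` pushes the support of `f` into the negative half line.
  have hzero : contourPairing a b (fun t => f (t + T)) k = 0 :=
    hk.contourPairing_eq_zero ha hb (contDiff_comp_add hf T) (hasCompactSupport_comp_add hc T)
      fun t ht => hfT _ fun h => by linarith [h.2]
  -- Integrating the derivative of `σ ↦ e^((z-w)σ) k(w)` over `[0, T]` brings in `(z - w) k(w)`,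
  -- which the resolvent equation replaces by `g(w) - g(z)`. Nothing is divided by `w - z`, so `w =
  -- z` is allowed.
  have hpt (s : ℝ) : k (contour a b s) = Complex.exp (z * T) * (k (contour a b s) *
      Complex.exp (contour a b s * (-1 * T : ℝ))) + (g z - g (contour a b s)) *
        ∫ σ in (0 : ℝ)..T, Complex.exp (z * σ) * Complex.exp (contour a b s * (-1 * σ : ℝ)) := by
    set w := contour a b s
    have hw := hres w (contour_mem_expRegion ha b s)
    have h1 : ∫ σ in (0 : ℝ)..T, (z - w) * k w *
        (Complex.exp (z * σ) * Complex.exp (w * (-1 * σ : ℝ))) =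
        k w * Complex.exp ((z - w) * T) - k w * Complex.exp ((z - w) * (0 : ℝ)) := by
      refine intervalIntegral.integral_eq_sub_of_hasDerivAt
        (f := fun σ : ℝ => k w * Complex.exp ((z - w) * σ)) (fun σ _ => ?_)
        (Continuous.intervalIntegrable (by fun_prop) _ _)
      have h2 := ((((hasDerivAt_id (σ : ℂ)).const_mul (z - w)).cexp).const_mul (k w)).comp_ofReal
      refine h2.congr_deriv ?_
      rw [← Complex.exp_add]
      push_cast
      simp only [id, mul_one]
      ring_nf
    rw [intervalIntegral.integral_const_mul] at h1
    have h3 : (z - w) * k w = -(g z - g w) := by rw [← hw]; ring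
    rw [h3, Complex.ofReal_zero, mul_zero, Complex.exp_zero, mul_one] at h1
    have h4 : Complex.exp ((z - w) * T) =
        Complex.exp (z * T) * Complex.exp (w * (-1 * T : ℝ)) := by
      rw [← Complex.exp_add]
      push_cast
      ring_nf
    rw [h4] at h1
    linear_combination h1
  set P : ℝ → ℂ := fun s => laplace f (contour a b s) * (g z - g (contour a b s)) with hPdef
  obtain ⟨K₁, hK₁⟩ := exists_laplace_contour_le ha hb hf hc 0 hT
  obtain ⟨K₂, hK₂⟩ := hg.exists_laplace_mul_le ha hb hf hc hT
  have hPb : ∀ s, Real.exp (T * (contour a b s).re) * ‖P s‖ ≤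
      (‖g z‖ * K₁ + K₂) * (1 + s ^ 2)⁻¹ := by
    intro s
    have e1 := hK₁ s
    rw [Real.rpow_zero, one_mul] at e1
    have e3 : ‖P s‖ ≤ ‖g z‖ * ‖laplace f (contour a b s)‖ +
        ‖laplace f (contour a b s) * g (contour a b s)‖ := by
      simp only [hPdef, mul_sub]
      refine (norm_sub_le _ _).trans (le_of_eq ?_)
      rw [norm_mul, mul_comm]
    calc _ ≤ Real.exp (T * (contour a b s).re) * (‖g z‖ * ‖laplace f (contour a b s)‖ +
          ‖laplace f (contour a b s) * g (contour a b s)‖) := by gcongr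
      _ = ‖g z‖ * (Real.exp (T * (contour a b s).re) * ‖laplace f (contour a b s)‖) +
          Real.exp (T * (contour a b s).re) *
            ‖laplace f (contour a b s) * g (contour a b s)‖ := by ring
      _ ≤ ‖g z‖ * (K₁ * (1 + s ^ 2)⁻¹) + K₂ * (1 + s ^ 2)⁻¹ := by
          exact add_le_add (mul_le_mul_of_nonneg_left e1 (norm_nonneg _)) (hK₂ s)
      _ = _ := by ring
  have hPc : Continuous P :=
    hlf.mul (continuous_const.sub (hg.continuous_comp_contour ha hb))
  have hswap := integral_contour_intervalIntegral_swap ha hb hPc hT hPb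
    (q := fun σ : ℝ => Complex.exp (z * σ)) (Continuous.continuousOn (by fun_prop))
    (c := -1) (by norm_num) |>.2
  have hsplit : contourPairing a b f k = Complex.exp (z * T) *
      contourPairing a b (fun t => f (t + T)) k + ∫ s, deriv (contour a b) s * (P s *
        ∫ σ in (0 : ℝ)..T, Complex.exp (z * σ) *
          Complex.exp (contour a b s * (-1 * σ : ℝ))) := by
    have hi1 := (hk.integrable ha hb (contDiff_comp_add hf T)
      (hasCompactSupport_comp_add hc T)).const_mul (Complex.exp (z * T))
    have heq (s : ℝ) : deriv (contour a b) s * (P s *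
        ∫ σ in (0 : ℝ)..T, Complex.exp (z * σ) * Complex.exp (contour a b s * (-1 * σ : ℝ))) =
        deriv (contour a b) s * (laplace f (contour a b s) * k (contour a b s)) -
        Complex.exp (z * T) * (deriv (contour a b) s *
          (laplace (fun t => f (t + T)) (contour a b s) * k (contour a b s))) := by
      have := hpt s
      rw [laplace_comp_add]
      have h5 : Complex.exp (-(contour a b s * T)) =
          Complex.exp (contour a b s * (-1 * T : ℝ)) := by push_cast; ring_nf
      rw [h5]
      simp only [hPdef]
      linear_combination (-(deriv (contour a b) s * laplace f (contour a b s))) * this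
    simp only [heq]
    rw [integral_sub (hk.integrable ha hb hf hc) hi1, integral_const_mul]
    simp only [contourPairing]
    ring
  rw [hsplit, hzero, mul_zero, zero_add, hswap]
  refine intervalIntegral.integral_congr fun σ _ => ?_
  refine congrArg _ ?_
  have hfσ := contDiff_comp_add hf σ
  have hcσ := hasCompactSupport_comp_add hc σ
  have e1 := integral_contour_laplace ha hb hfσ hcσ
  rw [zero_add] at e1
  have hi1 : Integrable fun s => deriv (contour a b) s *
      laplace (fun t => f (t + σ)) (contour a b s) := by
    obtain ⟨K', hK'⟩ := exists_laplace_contour_le ha hb hfσ hcσ 0 le_rfl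
    exact integrable_deriv_contour_mul ha hb
      (continuous_laplace_contour ha hb hfσ.continuous hcσ) fun s => by simpa using hK' s
  rw [← e1, contourPairing, ← integral_mul_const,
    ← integral_sub (hi1.mul_const _) (hg.integrable ha hb hfσ hcσ)]
  congr 1
  funext s
  rw [laplace_comp_add]
  simp only [hPdef]
  push_cast
  ring_nf

end ScalarContour

/-! ### The product formula for scalar pairings. -/

section ScalarConvolution

variable {a b α : ℝ}

/-- The left side is the expression of `contourPairing_resolvent` integrated against `ψ̂`. Its first
term already matches the first term of `hat_finiteConv`; the second matches after Fubini and the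
inversion formula. -/
theorem IsSlowlyGrowing.integral_contour_finiteConv {g : ℂ → ℂ} (hg : IsSlowlyGrowing a b α g)
    (ha : 0 < a) (hb : 0 < b) (φ ψ : Test) {T : ℝ} (hT : 0 ≤ T)
    (hφ : ∀ t, t ∉ Icc (-T) T → φ t = 0) (hψ : ∀ t, t ∉ Icc (-T) T → ψ t = 0) :
    ∫ s, deriv (contour a b) s * (hat ψ (contour a b s) *
      ∫ σ in (0 : ℝ)..T, Complex.exp (contour a b s * σ) *
        (Complex.I * φ σ * g (contour a b s) - contourPairing a b (fun t => φ (t + σ)) g)) =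
      Complex.I * contourPairing a b (finiteConv φ ψ) g := by
  have hφc := φ.continuous
  have hψc := ψ.continuous
  have hgc := hg.continuous_comp_contour ha hb
  have hlφ := continuous_laplace_contour ha hb hφc φ.hasCompactSupport
  have hlψ := continuous_laplace_contour ha hb hψc ψ.hasCompactSupport
  obtain ⟨K₁, hK₁⟩ := hg.exists_laplace_mul_le ha hb ψ.contDiff ψ.hasCompactSupport hT
  obtain ⟨K₂, hK₂⟩ := exists_laplace_contour_le ha hb ψ.contDiff ψ.hasCompactSupport 0 hT
  obtain ⟨K₃, hK₃⟩ := hg.exists_laplace_mul_le ha hb φ.contDiff φ.hasCompactSupport hT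
  simp only [Real.rpow_zero, one_mul] at hK₂
  set M : ℝ → ℂ := fun σ => contourPairing a b (fun t => φ (t + σ)) g with hMdef
  have hM : ContinuousOn M (Icc 0 T) :=
    (hg.continuousOn_contourPairing_comp_add ha hb φ.contDiff φ.hasCompactSupport).mono
      fun σ hσ => hσ.1
  have h1 := integral_contour_intervalIntegral_swap ha hb
    (P := fun s => laplace ψ (contour a b s) * g (contour a b s)) (hlψ.mul hgc) hT hK₁
    (q := fun σ => Complex.I * φ σ) (Continuous.continuousOn (by fun_prop)) (c := 1) le_rfl
  have h2 := integral_contour_intervalIntegral_swap ha hb hlψ hT hK₂ hM (c := 1) le_rfl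
  have h3 := integral_contour_intervalIntegral_swap ha hb
    (P := fun s => laplace φ (contour a b s) * g (contour a b s)) (hlφ.mul hgc) hT hK₃
    (q := fun σ => Complex.I * ψ (-σ)) (Continuous.continuousOn (by fun_prop)) (c := -1)
    (by norm_num)
  -- Both double integrals equal `∫ i ψ(-σ) M(σ) dσ` over `[0, T]`: in one, the contour integral of
  -- `ψ̂(z) e^(zσ)` is `i ψ(-σ)`; in the other, the contour integral of `φ̂ g e^(-zσ)` is `M σ`.
  have h23 := h2.2.trans (h3.2.trans (intervalIntegral.integral_congr fun σ _ => by
    rw [← contourPairing_comp_add,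
      integral_contour_laplace_mul_exp ha hb ψ.contDiff ψ.hasCompactSupport, one_mul]
    ring)).symm
  have hL (s : ℝ) : deriv (contour a b) s * (hat ψ (contour a b s) *
      ∫ σ in (0 : ℝ)..T, Complex.exp (contour a b s * σ) *
        (Complex.I * φ σ * g (contour a b s) - M σ)) =
      deriv (contour a b) s * (laplace ψ (contour a b s) * g (contour a b s) *
        ∫ σ in (0 : ℝ)..T, Complex.I * φ σ * Complex.exp (contour a b s * (1 * σ : ℝ))) -
      deriv (contour a b) s * (laplace ψ (contour a b s) *
        ∫ σ in (0 : ℝ)..T, M σ * Complex.exp (contour a b s * (1 * σ : ℝ))) := by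
    have e : ∫ σ in (0 : ℝ)..T, Complex.exp (contour a b s * σ) *
        (Complex.I * φ σ * g (contour a b s) - M σ) =
        (∫ σ in (0 : ℝ)..T, Complex.I * φ σ * Complex.exp (contour a b s * (1 * σ : ℝ))) *
          g (contour a b s) -
        ∫ σ in (0 : ℝ)..T, M σ * Complex.exp (contour a b s * (1 * σ : ℝ)) := by
      rw [← intervalIntegral.integral_mul_const, ← intervalIntegral.integral_sub]
      · refine intervalIntegral.integral_congr fun σ _ => ?_
        simp only [one_mul]
        ring
      · exact Continuous.intervalIntegrable (by fun_prop) _ _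
      · refine ContinuousOn.intervalIntegrable ?_
        rw [uIcc_of_le hT]
        exact hM.mul (Continuous.continuousOn (by fun_prop))
    rw [e, hat_eq_laplace]
    ring
  have hR (s : ℝ) : Complex.I * (deriv (contour a b) s *
      (laplace (finiteConv φ ψ) (contour a b s) * g (contour a b s))) =
      deriv (contour a b) s * (laplace ψ (contour a b s) * g (contour a b s) *
        ∫ σ in (0 : ℝ)..T, Complex.I * φ σ * Complex.exp (contour a b s * (1 * σ : ℝ))) -
      deriv (contour a b) s * (laplace φ (contour a b s) * g (contour a b s) *
        ∫ σ in (0 : ℝ)..T, Complex.I * ψ (-σ) * Complex.exp (contour a b s * (-1 * σ : ℝ))) := by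
    have e := hat_finiteConv φ ψ hT hφ hψ (contour a b s)
    rw [hat_eq_laplace, hat_eq_laplace, hat_eq_laplace] at e
    rw [e]
    simp only [mul_assoc Complex.I, intervalIntegral.integral_const_mul]
    push_cast
    simp only [one_mul, neg_mul, mul_neg]
    ring
  rw [integral_congr_ae (.of_forall hL), integral_sub h1.1 h2.1, h23, ← integral_sub h1.1 h3.1, contourPairing, ← integral_const_mul]
  congr 1
  funext s
  exact (hR s).symm

end ScalarConvolution

/-! ### From operator families to scalar functions. -/

section DualPairing

variable {E : Type*} [AddCommGroup E] [Module ℂ E] [TopologicalSpace E]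

theorem _root_.DifferentiableWithinAt.clm_comp_of_tvs {f : ℂ → E} {s : Set ℂ} {z : ℂ}
    (hf : DifferentiableWithinAt ℂ f s z) (l : E →L[ℂ] ℂ) :
    DifferentiableWithinAt ℂ (fun w => l (f w)) s z := by
  obtain ⟨f', hf'⟩ := hf
  refine ⟨l ∘L f', .of_isLittleOTVS ?_⟩
  refine (l.isBigOTVS_comp.trans_isLittleOTVS hf'.isLittleOTVS).congr_left fun w => ?_
  simp only [Function.comp_apply, map_sub, ContinuousLinearMap.comp_apply]

/-- Operator families on `E(a, b)`, strongly holomorphic inside, strongly continuous up to the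
boundary and of growth `O(|z|^α)` with respect to the continuous seminorms. -/
structure IsTemperedFamily (a b α : ℝ) (F : ℂ → (E →L[ℂ] E)) : Prop where
  differentiableOn : ∀ x : E, DifferentiableOn ℂ (fun z => F z x) (openExpRegion a b)
  continuousOn : ∀ x : E, ContinuousOn (fun z => F z x) (expRegion a b)
  exists_bound : ∀ p : Seminorm ℂ E, Continuous p → ∃ q : Seminorm ℂ E, Continuous q ∧
    ∀ z ∈ expRegion a b, ∀ x, p (F z x) ≤ (1 + ‖z‖) ^ α * q x

variable {a b α : ℝ} {F : ℂ → (E →L[ℂ] E)}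

theorem IsTemperedFamily.isSlowlyGrowing (hF : IsTemperedFamily a b α F) (l : E →L[ℂ] ℂ) (x : E) :
    IsSlowlyGrowing a b α fun z => l (F z x) := by
  refine ⟨?_, l.continuous.comp_continuousOn (hF.continuousOn x), ?_⟩
  · intro z hz
    exact (hF.differentiableOn x z hz).clm_comp_of_tvs l
  · obtain ⟨q, -, hq⟩ := hF.exists_bound l.toLinearMap.toSeminorm l.continuous.norm
    exact ⟨q x, apply_nonneg q x, fun z hz => (hq z hz x).trans_eq (mul_comm _ _)⟩

theorem HasContourIntegral.dual_eq {f : ℝ → ℂ} {x I : E}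
    (hI : HasContourIntegral a b (fun z => laplace f z • F z x) I) (l : E →L[ℂ] ℂ) :
    l I = contourPairing a b f fun z => l (F z x) := by
  rw [← (hI.2 l).2, contourPairing]
  simp only [map_smul, smul_eq_mul]

end DualPairing

/-! ### Existence and seminorm bounds of the contour integrals. -/

section OperatorFamily

variable {E : Type*} [AddCommGroup E] [Module ℂ E] [UniformSpace E]
  [IsUniformAddGroup E] [ContinuousSMul ℂ E]

variable {a b α : ℝ} {F : ℂ → (E →L[ℂ] E)}

theorem IsTemperedFamily.of_equicontinuous [LocallyConvexSpace ℝ E]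
    (hFan : ∀ x : E, DifferentiableOn ℂ (fun z => F z x) (openExpRegion a b))
    (hFcont : ∀ x : E, ContinuousOn (fun z => F z x) (expRegion a b))
    (hFeq : Equicontinuous (fun (z : expRegion a b) (x : E) =>
      (((1 + ‖(z : ℂ)‖) ^ (-α) : ℝ) : ℂ) • F z x)) : IsTemperedFamily a b α F := by
  refine ⟨hFan, hFcont, fun p hp => ?_⟩
  have := polynormableSpace_complex (E := E)
  have h := ((PolynormableSpace.withSeminorms ℂ E).equicontinuous_TFAE
    (fun z : expRegion a b =>
      ((((1 + ‖(z : ℂ)‖) ^ (-α) : ℝ) : ℂ) • (F z : E →ₗ[ℂ] E)))).out 1 3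
  obtain ⟨q, hq, hle⟩ := h.1 hFeq ⟨p, hp⟩
  refine ⟨q, hq, fun z hz x => ?_⟩
  have h1 : ‖(((1 + ‖z‖) ^ (-α) : ℝ) : ℂ)‖ * p (F z x) ≤ q x := by
    rw [← map_smul_eq_mul]
    exact hle ⟨z, hz⟩ x
  have h0 : 0 < 1 + ‖z‖ := by positivity
  rw [Complex.norm_real, Real.norm_of_nonneg (by positivity), Real.rpow_neg h0.le,
    inv_mul_le_iff₀ (by positivity)] at h1
  exact h1

theorem IsTemperedFamily.exists_hasContourIntegral [LocallyConvexSpace ℝ E]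
    (hF : IsTemperedFamily a b α F) (hE : SeqComplete E) (ha : 0 < a) (hb : 0 < b)
    {f : ℝ → ℂ} (hf : ContDiff ℝ ∞ f) (hc : HasCompactSupport f) (x : E) :
    ∃ I, HasContourIntegral a b (fun z => laplace f z • F z x) I := by
  have hγ := continuous_contour ha hb
  have h0 (s : ℝ) : 0 < 1 + ‖contour a b s‖ := by positivity
  have hpow (β : ℝ) : Continuous fun s => (1 + ‖contour a b s‖) ^ β :=
    (continuous_const.add hγ.norm).rpow_const fun s => Or.inl (h0 s).ne'
  obtain ⟨K, hK⟩ := exists_laplace_contour_le ha hb hf hc α le_rfl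
  -- The factor `(1 + |z|)^α` is moved from `F` to the scalar density; what remains of `F` is
  -- bounded in every continuous seminorm.
  have hm : Integrable fun s => deriv (contour a b) s *
      (laplace f (contour a b s) * (((1 + ‖contour a b s‖) ^ α : ℝ) : ℂ)) := by
    refine integrable_deriv_contour_mul ha hb ((continuous_laplace_contour ha hb
      hf.continuous hc).mul (Complex.continuous_ofReal.comp (hpow α))) (K := K) fun s => ?_
    have := hK s
    rw [zero_mul, Real.exp_zero, mul_one] at this
    rwa [norm_mul, Complex.norm_real, Real.norm_of_nonneg (Real.rpow_nonneg (h0 s).le _), mul_comm]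
  obtain ⟨I, hI⟩ := exists_hasIntegral_smul hE hm
    (Φ := fun s => (((1 + ‖contour a b s‖) ^ (-α) : ℝ) : ℂ) • F (contour a b s) x)
    ((Complex.continuous_ofReal.comp (hpow _)).smul
      ((hF.continuousOn x).comp_continuous hγ (contour_mem_expRegion ha b)))
    (fun p hp => by
      obtain ⟨q, -, hq⟩ := hF.exists_bound p hp
      refine ⟨q x, fun s => ?_⟩
      rw [map_smul_eq_mul, Complex.norm_real, Real.norm_of_nonneg (Real.rpow_nonneg (h0 s).le _),
        Real.rpow_neg (h0 s).le, inv_mul_le_iff₀ (Real.rpow_pos_of_pos (h0 s) _)]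
      exact hq _ (contour_mem_expRegion ha b s) x)
  refine ⟨I, ?_⟩
  have hfun : (fun s => deriv (contour a b) s • (laplace f (contour a b s) •
      F (contour a b s) x)) = fun s => (deriv (contour a b) s *
        (laplace f (contour a b s) * (((1 + ‖contour a b s‖) ^ α : ℝ) : ℂ))) •
        (((1 + ‖contour a b s‖) ^ (-α) : ℝ) : ℂ) • F (contour a b s) x := ?_
  · rw [HasContourIntegral, hfun]
    exact hI
  funext s
  rw [smul_smul, smul_smul]
  congr 1
  rw [mul_assoc, mul_assoc, ← Complex.ofReal_mul, ← Real.rpow_add (h0 s), add_neg_cancel,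
    Real.rpow_zero, Complex.ofReal_one, mul_one]

/-- The bound is linear in the decay constant `K` and in `q x`: the latter gives continuity of each
operator, the former continuity in the test function. The `π` is `∫ (1 + s²)⁻¹ ds`. -/
theorem HasContourIntegral.seminorm_le [LocallyConvexSpace ℝ E] (ha : 0 < a) (hb : 0 < b)
    {f : ℝ → ℂ} {x I : E}
    (hI : HasContourIntegral a b (fun z => laplace f z • F z x) I) {p q : Seminorm ℂ E}
    (hp : Continuous p)
    (hq : ∀ z ∈ expRegion a b, ∀ x, p (F z x) ≤ (1 + ‖z‖) ^ α * q x) {K : ℝ}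
    (hK : ∀ s, (1 + ‖contour a b s‖) ^ α * ‖laplace f (contour a b s)‖ ≤ K * (1 + s ^ 2)⁻¹) :
    p I ≤ (1 / a + 1) * Real.pi * K * q x := by
  refine (HasIntegral.seminorm_le hI hp).trans ?_
  have : (1 / a + 1) * Real.pi * K * q x = ∫ s : ℝ, (1 / a + 1) * K * q x * (1 + s ^ 2)⁻¹ := by
    rw [integral_const_mul, integral_univ_inv_one_add_sq]
    ring
  rw [this]
  refine integral_mono (hI.1 p hp) (integrable_inv_one_add_sq.const_mul _) fun s => ?_
  simp only [map_smul_eq_mul]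
  calc _ ≤ (1 / a + 1) * (‖laplace f (contour a b s)‖ * ((1 + ‖contour a b s‖) ^ α * q x)) := by
        gcongr
        · exact norm_deriv_contour_le ha hb s
        · exact hq _ (contour_mem_expRegion ha b s) x
    _ = (1 / a + 1) * q x * ((1 + ‖contour a b s‖) ^ α * ‖laplace f (contour a b s)‖) := by ring
    _ ≤ (1 / a + 1) * q x * (K * (1 + s ^ 2)⁻¹) := by
        refine mul_le_mul_of_nonneg_left (hK s) ?_
        have := apply_nonneg q x
        positivity
    _ = _ := by ring

end OperatorFamily

/-! ### Uniform estimates for test functions. -/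

section TestFunctions

/-- The transform of test functions supported in a fixed compact set decays along the contour,
uniformly with respect to two of the seminorms defining their topology. -/
theorem exists_uniform_laplace_contour_le {a b : ℝ} (ha : 0 < a) (hb : 0 < b) (α : ℝ)
    (K : TopologicalSpace.Compacts ℝ) :
    ∃ (k : ℕ) (c : ℝ), 0 ≤ c ∧ ∀ (φ : 𝓓_{K}(ℝ, ℂ)) (s : ℝ),
      (1 + ‖contour a b s‖) ^ α * ‖laplace φ (contour a b s)‖ ≤
        c * (ContDiffMapSupportedIn.seminorm ℂ ℝ ℂ ⊤ K 0 φ +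
          ContDiffMapSupportedIn.seminorm ℂ ℝ ℂ ⊤ K k φ) * (1 + s ^ 2)⁻¹ := by
  obtain ⟨R, hR0, hR⟩ := K.isCompact.isBounded.subset_closedBall_lt 0 0
  rw [Real.closedBall_eq_Icc, zero_sub, zero_add] at hR
  obtain ⟨k, hk⟩ := exists_nat_ge (α + 2 + (R + 0) / a)
  refine ⟨k, 2 ^ k * (R - -R) * Real.exp ((R + 0) * b), by
    have : 0 ≤ R - -R := by linarith
    positivity, fun φ s => ?_⟩
  have hs : ∀ t, t ∉ Icc (-R) R → φ t = 0 := fun t ht =>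
    φ.zero_on_compl fun h => ht (hR h)
  have hn (i : ℕ) (t : ℝ) : ‖iteratedDeriv i φ t‖ ≤
      ContDiffMapSupportedIn.seminorm ℂ ℝ ℂ ⊤ K i φ := by
    rw [← norm_iteratedFDeriv_eq_norm_iteratedDeriv]
    exact ContDiffMapSupportedIn.norm_iteratedFDeriv_apply_le_seminorm_top ℂ
  have h0 (t : ℝ) : ‖φ t‖ ≤ ContDiffMapSupportedIn.seminorm ℂ ℝ ℂ ⊤ K 0 φ :=
    ContDiffMapSupportedIn.norm_apply_le_seminorm ℂ
  have h1 := one_add_norm_pow_mul_norm_laplace_le φ.contDiff (by linarith : -R ≤ R) hs k h0 (hn k)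
    (hb.le.trans (le_contour_re a b s))
  have h2 := rpow_mul_exp_mul_le ha hb (α := α) (T := 0) (by linarith) hk
    (one_add_abs_le_one_add_norm_contour a b s) (by
      have : 0 ≤ R - -R := by linarith
      have h3 := apply_nonneg (ContDiffMapSupportedIn.seminorm ℂ ℝ ℂ ⊤ K 0) φ
      have h4 := apply_nonneg (ContDiffMapSupportedIn.seminorm ℂ ℝ ℂ ⊤ K k) φ
      positivity) h1
  rw [zero_mul, Real.exp_zero, mul_one] at h2
  refine h2.trans (le_of_eq ?_)
  ring

theorem exists_common_support (φ ψ : Test) : ∃ T, 0 ≤ T ∧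
    (∀ t, t ∉ Icc (-T) T → φ t = 0) ∧ ∀ t, t ∉ Icc (-T) T → ψ t = 0 := by
  obtain ⟨R, hR0, hR⟩ := exists_Icc_of_hasCompactSupport φ.hasCompactSupport
  obtain ⟨S, hS0, hS⟩ := exists_Icc_of_hasCompactSupport ψ.hasCompactSupport
  refine ⟨max R S, hR0.le.trans (le_max_left _ _), fun t ht => hR t fun h => ht ?_,
    fun t ht => hS t fun h => ht ?_⟩
  · exact Icc_subset_Icc (neg_le_neg (le_max_left _ _)) (le_max_left _ _) h
  · exact Icc_subset_Icc (neg_le_neg (le_max_right _ _)) (le_max_right _ _) h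

theorem hat_negDeltaDerivConv (φ : Test) (z : ℂ) : hat (negDeltaDerivConv φ) z = z * hat φ z := by
  have h : (negDeltaDerivConv φ : ℝ → ℂ) = (-1 : ℂ) • deriv φ := by
    rw [neg_one_smul]
    exact negDeltaDerivConv_eq φ
  rw [hat_eq_laplace, h, laplace_smul, laplace_deriv φ.contDiff φ.hasCompactSupport,
    hat_eq_laplace]
  ring

theorem apply_zero_of_mem_Test₀ {φ : Test} (hφ : φ ∈ Test₀) : φ 0 = 0 := by
  have h : EqOn φ 0 (Iio 0) := fun t ht => by
    by_contra h
    have h1 : (0 : ℝ) ≤ t := hφ (subset_tsupport φ h)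
    exact absurd h1 (not_le.2 ht)
  have := h.closure φ.continuous continuous_zero
  rw [closure_Iio] at this
  exact this self_mem_Iic

end TestFunctions

/-! ### Construction of the operator-valued distribution. -/

section Construction

variable {E : Type*} [AddCommGroup E] [Module ℂ E] [UniformSpace E]
  [IsUniformAddGroup E] [ContinuousSMul ℂ E] [LocallyConvexSpace ℝ E]

/-- Continuity of a linear map from test functions with support in a fixed compact set to the
space of continuous linear operators. -/
theorem continuous_of_seminorm_le {V : Type*} [AddCommGroup V] [Module ℂ V] [TopologicalSpace V]
    [IsTopologicalAddGroup V] (G : V →ₗ[ℂ] (E →L[ℂ] E))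
    (h : ∀ p : Seminorm ℂ E, Continuous p → ∃ (q : Seminorm ℂ E) (N : V → ℝ), Continuous q ∧
      Tendsto N (𝓝 0) (𝓝 0) ∧ ∀ v x, p (G v x) ≤ N v * q x) : Continuous G := by
  have := polynormableSpace_complex (E := E)
  refine continuous_of_tendsto_nhds_zero G ?_
  rw [ContinuousLinearMap.hasBasis_nhds_zero.tendsto_right_iff]
  rintro ⟨S, U⟩ ⟨hS, hU⟩
  have hw := PolynormableSpace.withSeminorms ℂ E
  obtain ⟨t, r, hr, ht⟩ := (hw.mem_nhds_iff 0 U).1 hU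
  -- A finite supremum of continuous seminorms is again one, so a single estimate handles the whole
  -- neighbourhood `U`.
  have hp : Continuous (t.sup fun p : {p : Seminorm ℂ E // Continuous p} => p.1 :
      Seminorm ℂ E) :=
    Seminorm.continuous_finsetSup fun p _ => p.2
  obtain ⟨q, N, hq, hN, hle⟩ := h _ hp
  obtain ⟨M, hM0, hM⟩ := hw.isVonNBounded_iff_seminorm_bounded.1 hS ⟨q, hq⟩
  have h1 : Tendsto (fun v => |N v| * M) (𝓝 0) (𝓝 0) := by
    simpa using hN.abs.mul_const M
  filter_upwards [h1.eventually (gt_mem_nhds hr)] with v hv x hx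
  refine ht ?_
  rw [Seminorm.mem_ball, sub_zero]
  refine (hle v x).trans_lt (lt_of_le_of_lt ?_ hv)
  refine (mul_le_mul_of_nonneg_right (le_abs_self _) (apply_nonneg q x)).trans ?_
  exact mul_le_mul_of_nonneg_left (hM x hx).le (abs_nonneg _)

variable {a b α : ℝ} {F : ℂ → (E →L[ℂ] E)}

/-- A linear map on test functions that satisfies the estimates of the contour integrals is
continuous. -/
theorem IsTemperedFamily.continuous_of_forall_seminorm_le (hF : IsTemperedFamily a b α F)
    (ha : 0 < a) (hb : 0 < b) {G : Test →ₗ[ℂ] (E →L[ℂ] E)}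
    (hG : ∀ (φ : Test) (p q : Seminorm ℂ E), Continuous p →
      (∀ z ∈ expRegion a b, ∀ x, p (F z x) ≤ (1 + ‖z‖) ^ α * q x) → ∀ K : ℝ,
      (∀ s, (1 + ‖contour a b s‖) ^ α * ‖laplace φ (contour a b s)‖ ≤ K * (1 + s ^ 2)⁻¹) →
      ∀ x : E, p (G φ x) ≤ (1 / a + 1) * Real.pi * K * q x) : Continuous G := by
  have : ContinuousSMul ℝ E := IsScalarTower.continuousSMul ℂ
  have : ContinuousSMul ℝ (E →L[ℂ] E) := IsScalarTower.continuousSMul ℂ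
  -- By the LF topology it suffices to treat test functions supported in one compact set at a time.
  rw [TestFunction.continuous_iff_continuous_comp]
  intro K hKΩ
  obtain ⟨k, c, hc0, hc⟩ := exists_uniform_laplace_contour_le ha hb α K
  refine continuous_of_seminorm_le
    (G ∘ₗ (TestFunction.ofSupportedInCLM ℂ hKΩ).toLinearMap) fun p hp => ?_
  obtain ⟨q, hq, hle⟩ := hF.exists_bound p hp
  refine ⟨q, fun φ => (1 / a + 1) * Real.pi * (c * (ContDiffMapSupportedIn.seminorm ℂ ℝ ℂ ⊤ K 0 φ +
        ContDiffMapSupportedIn.seminorm ℂ ℝ ℂ ⊤ K k φ)), hq, ?_, fun φ x => ?_⟩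
  · have hs (i : ℕ) := (ContDiffMapSupportedIn.withSeminorms ℂ ℝ ℂ ⊤ K).continuous_seminorm i
    have : Continuous fun φ : 𝓓_{K}(ℝ, ℂ) => (1 / a + 1) * Real.pi *
        (c * (ContDiffMapSupportedIn.seminorm ℂ ℝ ℂ ⊤ K 0 φ +
          ContDiffMapSupportedIn.seminorm ℂ ℝ ℂ ⊤ K k φ)) :=
      continuous_const.mul (continuous_const.mul ((hs 0).add (hs k)))
    simpa using this.tendsto 0
  · exact hG (TestFunction.ofSupportedInCLM ℂ hKΩ φ) p q hp hle _ (hc φ) x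

/-- The operator valued distribution defined by the contour integrals. -/
theorem IsTemperedFamily.exists_distribution [T2Space E] (hF : IsTemperedFamily a b α F)
    (hE : SeqComplete E) (ha : 0 < a) (hb : 0 < b) :
    ∃ G : OpDistribution E, ∀ (φ : Test) (x : E), ∃ I : E,
      HasContourIntegral a b (fun z => hat φ z • F z x) I ∧ G φ x = (-Complex.I) • I := by
  have := polynormableSpace_complex (E := E)
  -- `J` is a mere choice of integrals; linearity in `x` and in `φ` is recovered from its values
  -- under functionals.
  choose J hJ using fun (φ : Test) (x : E) =>
    hF.exists_hasContourIntegral hE ha hb φ.contDiff φ.hasCompactSupport x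
  have hdual (φ : Test) (x : E) (l : E →L[ℂ] ℂ) :
      l ((-Complex.I) • J φ x) = -Complex.I * contourPairing a b φ fun z => l (F z x) := by
    rw [map_smul, (hJ φ x).dual_eq l, smul_eq_mul]
  have hint (φ : Test) (x : E) (l : E →L[ℂ] ℂ) :=
    (hF.isSlowlyGrowing l x).integrable ha hb φ.contDiff φ.hasCompactSupport
  have hbound (φ : Test) {p q : Seminorm ℂ E} (hp : Continuous p)
      (hq : ∀ z ∈ expRegion a b, ∀ x, p (F z x) ≤ (1 + ‖z‖) ^ α * q x) {K : ℝ}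
      (hK : ∀ s, (1 + ‖contour a b s‖) ^ α * ‖laplace φ (contour a b s)‖ ≤ K * (1 + s ^ 2)⁻¹)
      (x : E) : p ((-Complex.I) • J φ x) ≤ (1 / a + 1) * Real.pi * K * q x := by
    rw [map_smul_eq_mul, norm_neg, Complex.norm_I, one_mul]
    exact (hJ φ x).seminorm_le ha hb hp hq hK
  let L (φ : Test) : E →ₗ[ℂ] E :=
    { toFun := fun x => (-Complex.I) • J φ x
      map_add' := fun x y => eq_of_forall_dual_eq fun l => by
        simp only [map_add, hdual, contourPairing, mul_add]
        rw [integral_add (hint φ x l) (hint φ y l), mul_add]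
      map_smul' := fun c x => eq_of_forall_dual_eq fun l => by
        rw [RingHom.id_apply, map_smul l c, hdual, hdual, smul_eq_mul, mul_left_comm]
        congr 1
        rw [contourPairing, contourPairing, ← integral_const_mul]
        congr 1
        funext s
        simp only [map_smul, smul_eq_mul]
        ring }
  have hLc (φ : Test) : Continuous (L φ) := by
    obtain ⟨K, hK⟩ := exists_laplace_contour_le ha hb φ.contDiff φ.hasCompactSupport α le_rfl
    have hK' (s : ℝ) : (1 + ‖contour a b s‖) ^ α * ‖laplace φ (contour a b s)‖ ≤
        |K| * (1 + s ^ 2)⁻¹ := by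
      have := hK s
      rw [zero_mul, Real.exp_zero, mul_one] at this
      refine this.trans ?_
      gcongr
      exact le_abs_self K
    refine (PolynormableSpace.withSeminorms ℂ E).continuous_of_isBounded
      (PolynormableSpace.withSeminorms ℂ E) (L φ) fun p => ?_
    obtain ⟨q, hq, hle⟩ := hF.exists_bound p.1 p.2
    refine ⟨{⟨q, hq⟩}, ⟨(1 / a + 1) * Real.pi * |K|, by positivity⟩, fun x => ?_⟩
    rw [Finset.sup_singleton]
    change p.1 ((-Complex.I) • J φ x) ≤ (1 / a + 1) * Real.pi * |K| * q x
    exact hbound φ p.2 hle hK' x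
  let G : Test →ₗ[ℂ] (E →L[ℂ] E) :=
    { toFun := fun φ => ⟨L φ, hLc φ⟩
      map_add' := fun φ ψ => by
        ext x
        refine eq_of_forall_dual_eq fun l => ?_
        change l ((-Complex.I) • J (φ + ψ) x) = l ((-Complex.I) • J φ x + (-Complex.I) • J ψ x)
        rw [map_add, hdual, hdual, hdual, ← mul_add]
        congr 1
        rw [contourPairing, contourPairing, contourPairing,
          ← integral_add (hint φ x l) (hint ψ x l)]
        congr 1
        funext s
        have : ((φ + ψ : Test) : ℝ → ℂ) = (φ : ℝ → ℂ) + ψ := rfl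
        rw [this, laplace_add φ.continuous φ.hasCompactSupport ψ.continuous ψ.hasCompactSupport]
        ring
      map_smul' := fun c φ => by
        ext x
        refine eq_of_forall_dual_eq fun l => ?_
        change l ((-Complex.I) • J (c • φ) x) = l (c • (-Complex.I) • J φ x)
        rw [map_smul l c, hdual, hdual, smul_eq_mul, mul_left_comm]
        congr 1
        rw [contourPairing, contourPairing, ← integral_const_mul]
        congr 1
        funext s
        have : ((c • φ : Test) : ℝ → ℂ) = c • (φ : ℝ → ℂ) := rfl
        rw [this, laplace_smul]
        ring }
  have hG : Continuous G := hF.continuous_of_forall_seminorm_le ha hb fun φ p q hp hq K hK x =>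
    hbound φ hp hq hK x
  exact ⟨⟨G, hG⟩, fun φ x => ⟨J φ x, hJ φ x, rfl⟩⟩

end Construction

/-! ### Support, product formula and generator. -/

section Distribution

variable {E : Type*} [AddCommGroup E] [Module ℂ E] [UniformSpace E]
  [IsUniformAddGroup E] [ContinuousSMul ℂ E]

theorem dual_apply_of_hasContourIntegral {a b : ℝ} {F : ℂ → (E →L[ℂ] E)} {G : OpDistribution E}
    (hG : ∀ (φ : Test) (x : E), ∃ I : E,
      HasContourIntegral a b (fun z => hat φ z • F z x) I ∧ G φ x = (-Complex.I) • I)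
    (φ : Test) (x : E) (l : E →L[ℂ] ℂ) :
    l (G φ x) = -Complex.I * contourPairing a b φ fun z => l (F z x) := by
  obtain ⟨I, hI, hGI⟩ := hG φ x
  rw [hGI, map_smul, HasContourIntegral.dual_eq hI l, smul_eq_mul]

variable [LocallyConvexSpace ℝ E] [T2Space E] {a b α : ℝ} {F : ℂ → (E →L[ℂ] E)}
  {G : OpDistribution E}

theorem IsTemperedFamily.dsupport_subset (hF : IsTemperedFamily a b α F) (ha : 0 < a) (hb : 0 < b)
    (hG : ∀ (φ : Test) (x : E) (l : E →L[ℂ] ℂ),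
      l (G φ x) = -Complex.I * contourPairing a b φ fun z => l (F z x)) :
    Distribution.dsupport (G : Test → (E →L[ℂ] E)) ⊆ Ici 0 := by
  refine sInter_subset_of_mem ⟨fun φ hφ => ?_, isClosed_Ici⟩
  ext x
  refine eq_of_forall_dual_eq fun l => ?_
  rw [hG, (hF.isSlowlyGrowing l x).contourPairing_eq_zero ha hb φ.contDiff φ.hasCompactSupport]
  · simp
  · intro t ht
    by_contra h
    exact hφ (subset_tsupport φ h) ht.le

theorem IsTemperedFamily.apply_finiteConv (hF : IsTemperedFamily a b α F) (ha : 0 < a) (hb : 0 < b)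
    {C : E →L[ℂ] E}
    (hres : ∀ w ∈ expRegion a b, ∀ z ∈ expRegion a b, ∀ x : E,
      (w - z) • F w (F z x) = F z (C x) - F w (C x))
    (hG : ∀ (φ : Test) (x : E) (l : E →L[ℂ] ℂ),
      l (G φ x) = -Complex.I * contourPairing a b φ fun z => l (F z x)) (φ ψ : Test) :
    G (finiteConv φ ψ) ∘L C = G φ ∘L G ψ := by
  ext x
  refine eq_of_forall_dual_eq fun l => ?_
  obtain ⟨T, hT, hφ, hψ⟩ := exists_common_support φ ψ
  have hg := hF.isSlowlyGrowing l (C x)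
  rw [ContinuousLinearMap.comp_apply, ContinuousLinearMap.comp_apply, hG]
  -- The composite `l ∘L G φ` is itself a continuous functional, so the pairing formula applies to
  -- `G ψ x` directly and no vector-valued double integral arises.
  change _ = (l ∘L G φ) (G ψ x)
  rw [hG]
  have hk (s : ℝ) : (l ∘L G φ) (F (contour a b s) x) =
      -Complex.I * ∫ σ in (0 : ℝ)..T, Complex.exp (contour a b s * σ) *
        (Complex.I * φ σ * l (F (contour a b s) (C x)) -
          contourPairing a b (fun t => φ (t + σ)) fun z => l (F z (C x))) := by
    -- For fixed `z` on the contour the resolvent lemma is used with `k(w) = l (F(w) F(z) x)` and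
    -- `g(w) = l (F(w) C x)`.
    rw [ContinuousLinearMap.comp_apply, hG, contourPairing_resolvent ha hb φ.contDiff hT hφ hg
      (hF.isSlowlyGrowing l (F (contour a b s) x)) (contour a b s)]
    intro w hw
    rw [← smul_eq_mul, ← map_smul, hres w hw _ (contour_mem_expRegion ha b s), map_sub]
  have hrw (s : ℝ) : deriv (contour a b) s * (laplace ψ (contour a b s) *
      (l ∘L G φ) (F (contour a b s) x)) = -Complex.I * (deriv (contour a b) s *
        (hat ψ (contour a b s) * ∫ σ in (0 : ℝ)..T, Complex.exp (contour a b s * σ) *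
          (Complex.I * φ σ * l (F (contour a b s) (C x)) -
            contourPairing a b (fun t => φ (t + σ)) fun z => l (F z (C x))))) := by
    rw [hk s, hat_eq_laplace]
    ring
  have hrhs : contourPairing a b ψ (fun z => (l ∘L G φ) (F z x)) =
      contourPairing a b (finiteConv φ ψ) fun z => l (F z (C x)) := by
    rw [contourPairing, integral_congr_ae (.of_forall hrw), integral_const_mul,
      hg.integral_contour_finiteConv ha hb φ ψ hT hφ hψ, ← mul_assoc, neg_mul, Complex.I_mul_I,
      neg_neg, one_mul]
  rw [hrhs]

/-- The two sides of the generator condition differ by a multiple of `l (C x) * ∫ φ̂ dz`, and this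
integral is `i φ(0) = 0`. -/
theorem IsTemperedFamily.le_generator (hF : IsTemperedFamily a b α F) (ha : 0 < a) (hb : 0 < b)
    {C : E →L[ℂ] E} {A : MLO E}
    (hleft : ∀ z ∈ expRegion a b, ∀ x y : E, (x, y) ∈ A → z • F z x - C x = F z y)
    (hG : ∀ (φ : Test) (x : E) (l : E →L[ℂ] ℂ),
      l (G φ x) = -Complex.I * contourPairing a b φ fun z => l (F z x)) :
    A ≤ generator G := by
  rintro ⟨x, y⟩ hxy φ hφ
  refine eq_of_forall_dual_eq fun l => ?_
  change l (G (negDeltaDerivConv φ) x) = l (G φ y)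
  rw [hG, hG]
  congr 1
  have hzero := integral_contour_laplace ha hb φ.contDiff φ.hasCompactSupport
  rw [apply_zero_of_mem_Test₀ hφ, mul_zero] at hzero
  have h1 := (hF.isSlowlyGrowing l x).integrable ha hb (negDeltaDerivConv φ).contDiff
    (negDeltaDerivConv φ).hasCompactSupport
  have h2 := (hF.isSlowlyGrowing l y).integrable ha hb φ.contDiff φ.hasCompactSupport
  rw [← sub_eq_zero, contourPairing, contourPairing, ← integral_sub h1 h2]
  have hrw (s : ℝ) : deriv (contour a b) s * (laplace (negDeltaDerivConv φ) (contour a b s) *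
        l (F (contour a b s) x)) - deriv (contour a b) s * (laplace φ (contour a b s) *
        l (F (contour a b s) y)) =
      deriv (contour a b) s * laplace φ (contour a b s) * l (C x) := by
    have e1 := hat_negDeltaDerivConv φ (contour a b s)
    rw [hat_eq_laplace, hat_eq_laplace] at e1
    have e2 := hleft _ (contour_mem_expRegion ha b s) x y hxy
    rw [e1, ← e2, map_sub, map_smul, smul_eq_mul]
    ring
  rw [integral_congr_ae (.of_forall hrw), integral_mul_const, hzero, zero_mul]

end Distribution

end DegenerateCDS

/-! ### The main theorem. -/

theorem theorem4p10 {E : Type*} [AddCommGroup E] [Module ℂ E] [UniformSpace E]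
    [IsUniformAddGroup E] [ContinuousSMul ℂ E] [LocallyConvexSpace ℝ E] [T2Space E]
    [BarrelledSpace ℂ E] (hE : SeqComplete E)
    (C : E →L[ℂ] E) (A : MLO E) (hA : IsClosed (A : Set (E × E)))
    (a b α : ℝ) (ha : 0 < a) (hb : 0 < b) (hα : 0 < α)
    (F : ℂ → (E →L[ℂ] E))
    (hFA : ∀ z ∈ expRegion a b, ∀ x y : E, (x, y) ∈ A → (F z x, F z y) ∈ A)
    (hFres : ∀ z ∈ expRegion a b, ∀ x : E, (C x, F z x) ∈ MLO.inverse (MLO.scalarSub z A))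
    (hFC : ∀ z ∈ expRegion a b, F z ∘L C = C ∘L F z)
    (hFleft : ∀ z ∈ expRegion a b, ∀ x y : E, (x, y) ∈ A → z • F z x - C x = F z y)
    (hFan : ∀ x : E, DifferentiableOn ℂ (fun z => F z x) (openExpRegion a b))
    (hFcont : ∀ x : E, ContinuousOn (fun z => F z x) (expRegion a b))
    (hFeq : Equicontinuous (fun (z : expRegion a b) (x : E) =>
      (((1 + ‖(z : ℂ)‖) ^ (-α) : ℝ) : ℂ) • F z x)) :
    ∃ G : OpDistribution E,
      (∀ (φ : Test) (x : E), ∃ I : E,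
        HasContourIntegral a b (fun z => hat φ z • F z x) I ∧ G φ x = (-Complex.I) • I) ∧
      IsPreCDS C G ∧ A ≤ generator G := by
  have hF := IsTemperedFamily.of_equicontinuous hFan hFcont hFeq
  obtain ⟨G, hG⟩ := hF.exists_distribution hE ha hb
  have hdual := dual_apply_of_hasContourIntegral hG
  -- The inclusion at `z` gives `(F(z) x, y) ∈ A` with `y = z F(z) x - C x`. The left identity at
  -- `w`, applied to this pair, reads `w F(w) F(z) x - C F(z) x = F(w) y`, and `C` commutes with
  -- `F(z)`.
  have hres : ∀ w ∈ expRegion a b, ∀ z ∈ expRegion a b, ∀ x : E,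
      (w - z) • F w (F z x) = F z (C x) - F w (C x) := by
    intro w hw z hz x
    obtain ⟨y, hy, hxy⟩ := hFres z hz x
    have hC (u : E) : F z (C u) = C (F z u) := DFunLike.congr_fun (hFC z hz) u
    have h1 := hFleft w hw _ _ hy
    simp only at hxy h1
    rw [hC, hxy, map_sub, map_smul, ← h1, sub_smul]
    abel
  refine ⟨G, hG, ⟨hF.dsupport_subset ha hb hdual, fun φ => ?_,
    hF.apply_finiteConv ha hb hres hdual⟩, hF.le_generator ha hb hFleft hdual⟩
  ext x
  refine eq_of_forall_dual_eq fun l => ?_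
  rw [ContinuousLinearMap.comp_apply, ContinuousLinearMap.comp_apply, hdual]
  change (l ∘L C) (G φ x) = _
  rw [hdual, contourPairing, contourPairing]
  congr 2
  funext s
  have := DFunLike.congr_fun (hFC _ (contour_mem_expRegion ha b s)) x
  simp only [ContinuousLinearMap.comp_apply] at this ⊢
  rw [this]
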